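/- Let $n\ge 2$, let $\Gamma$ be a discrete torsion-free group of isometries of real hyperbolic space $\mathbb H^n$ such that the complete hyperbolic manifold $M=\Gamma\backslash\mathbb H^n$ has finite volume, and let $T^1M=\Gamma\backslash T^1\mathbb H^n$. Let $d$ be the hyperbolic distance. For $\xi,\eta\in\partial_\infty\mathbb H^n$ and $x,y\in\mathbb H^n$, let $\beta_\xi(x,y)=\lim_{t\to+\infty}\big(d(\rho_\xi(t),x)-d(\rho_\xi(t),y)\big)$ be the Busemann cocycle and $d_x(\xi,\eta)=\lim_{t\to+\infty}e^{-\frac12(d(x,\rho_\xi(t))+d(x,\rho_\eta(t))-d(\rho_\xi(t),\rho_\eta(t)))}$ the visual distance seen from $x$, where $\rho_\xi$, $\rho_\eta$ are geodesic rays with points at infinity $\xi$, $\eta$. Let $\delta=\lim_{k\to+\infty}\frac1k\ln\operatorname{Card}\{\gamma\in\Gamma: d(x_0,\gamma x_0)\le k\}$ be the critical exponent of $\Gamma$. The spherical Patterson density $(\mu_x)_{x\in\mathbb H^n}$ is the family of measures on $\partial_\infty\mathbb H^n=\mathbb S^{n-1}$ (unit ball model, with centre $0$) such that $\mu_0$ is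 the Lebesgue (spherical) measure of $\mathbb S^{n-1}$, of total mass $\operatorname{Vol}(\mathbb S^{n-1})$, and $\frac{d\mu_x}{d\mu_0}(\xi)=e^{-(n-1)\beta_\xi(x,0)}$. For $v\in T^1\mathbb H^n$, let $v_-,v_+$ be the negative and positive endpoints of the geodesic line defined by $v$, and let $t$ be the signed distance to the footpoint of $v$ from the point closest to the base point $x_0\in\mathbb H^n$ on this oriented line. The Bowen–Margulis measure of $T^1\mathbb H^n$ is given in Hopf's parametrisation $v\mapsto(v_-,v_+,t)$ by $$d\widetilde m_{\rm BM}(v)=\frac{d\mu_{x_0}(v_-)\,d\mu_{x_0}(v_+)\,dt}{d_{x_0}(v_-,v_+)^{2\delta}},$$ and $m_{\rm BM}$ is the measure it induces on $T^1M$. The Liouville measure $\operatorname{Vol}_{T^1M}$ is the measure on $T^1M$ induced by the measure on $T^1\mathbb H^n$ that disintegrates over the Riemannian measure of $\mathbb H^n$ with the spherical measures of the unit tangent spheres $T^1_x\mathbb H^n$ as conditional measures. Then, for every base point $x_0\in\mathbb H^n$, $$m_{\rm BM}=2^{n-1}\,\operatorname{Vol}_{T^1M},$$ and, in particular, the total mass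 of $m_{\rm BM}$ is $$\|m_{\rm BM}\|=2^{n-1}\,\operatorname{Vol}(\mathbb S^{n-1})\,\operatorname{Vol}(M).$$ -/

import Mathlib

open MeasureTheory Filter Topology
open scoped RealInnerProductSpace

noncomputable section

namespace HypBM

/-! ### Real hyperbolic space: the hyperboloid model -/

/-- Euclidean `n`-space. -/
abbrev Euc (n : ℕ) : Type := EuclideanSpace ℝ (Fin n)

/-- Minkowski space `ℝ × ℝⁿ`; the first coordinate is the time coordinate. -/
abbrev Mink (n : ℕ) : Type := ℝ × Euc n

/-- The Minkowski bilinear form of signature `(n, 1)`. -/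
def mink {n : ℕ} (v w : Mink n) : ℝ := ⟪v.2, w.2⟫ - v.1 * w.1

/-- `x` lies on the upper sheet of the hyperboloid. -/
def IsHyp {n : ℕ} (x : Mink n) : Prop := mink x x = -1 ∧ 0 < x.1

/-- Real hyperbolic `n`-space. -/
abbrev Hyp (n : ℕ) : Type := {x : Mink n // IsHyp x}

/-- `(x, u)` is a unit tangent vector `u` at the point `x` of the hyperboloid. -/
def IsUnitTangent {n : ℕ} (v : Mink n × Mink n) : Prop :=
  IsHyp v.1 ∧ mink v.1 v.2 = 0 ∧ mink v.2 v.2 = 1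

/-- The unit tangent bundle `T¹ℍⁿ`. -/
abbrev UT (n : ℕ) : Type := {v : Mink n × Mink n // IsUnitTangent v}

/-- The sphere `S^{n-1}`. -/
abbrev Sph (n : ℕ) : Type := Metric.sphere (0 : Euc n) 1

/-- The hyperbolic distance. -/
def hdist {n : ℕ} (x y : Hyp n) : ℝ := Real.arcosh (-mink x.1 y.1)

/-- The origin of `ℍⁿ` (the centre of the ball model). -/
def origin (n : ℕ) : Hyp n := ⟨(1, 0), by simp [IsHyp, mink]⟩

theorem IsUnitTangent.abs_lt {n : ℕ} {v : Mink n × Mink n} (h : IsUnitTangent v) :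
    |v.2.1| < v.1.1 := by
  obtain ⟨⟨h1, h0⟩, h2, h3⟩ := h
  have hc := real_inner_mul_inner_self_le v.1.2 v.2.2
  simp only [mink] at h1 h2 h3
  apply abs_lt_of_sq_lt_sq _ h0.le
  have e1 : ⟪v.1.2, v.1.2⟫ = v.1.1 * v.1.1 - 1 := by linarith
  have e2 : ⟪v.1.2, v.2.2⟫ = v.1.1 * v.2.1 := by linarith
  have e3 : ⟪v.2.2, v.2.2⟫ = 1 + v.2.1 * v.2.1 := by linarith
  rw [e1, e2, e3] at hc
  nlinarith

theorem isHyp_geod {n : ℕ} {v : Mink n × Mink n} (h : IsUnitTangent v) (s : ℝ) :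
    IsHyp (Real.cosh s • v.1 + Real.sinh s • v.2) := by
  have habs := h.abs_lt
  obtain ⟨⟨h1, h0⟩, h2, h3⟩ := h
  simp only [mink] at h1 h2 h3
  constructor
  · have hs := Real.cosh_sq s
    have hcomm := real_inner_comm v.1.2 v.2.2
    simp only [mink, Prod.snd_add, Prod.smul_snd, Prod.fst_add, Prod.smul_fst, inner_add_left,
      inner_add_right, real_inner_smul_left, real_inner_smul_right, smul_eq_mul]
    rw [hcomm]
    linear_combination (Real.cosh s) ^ 2 * h1 + 2 * Real.cosh s * Real.sinh s * h2 +
      (Real.sinh s) ^ 2 * h3 - hs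
  · simp only [Prod.fst_add, Prod.smul_fst, smul_eq_mul]
    have hsc : |Real.sinh s| < Real.cosh s := by
      apply abs_lt_of_sq_lt_sq _ (Real.cosh_pos s).le
      rw [Real.cosh_sq]; linarith
    have hm : |Real.sinh s * v.2.1| < Real.cosh s * v.1.1 := by
      rw [abs_mul]
      exact mul_lt_mul'' hsc habs (abs_nonneg _) (abs_nonneg _)
    linarith [(abs_lt.mp hm).1]

/-- The geodesic line `s ↦ v(s)` with unit tangent vector `v` at time `0`. -/
def geod {n : ℕ} (v : UT n) (s : ℝ) : Hyp n :=
  ⟨Real.cosh s • v.1.1 + Real.sinh s • v.1.2, isHyp_geod v.2 s⟩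

/-- The footpoint projection `π : T¹ℍⁿ → ℍⁿ`. -/
def foot {n : ℕ} (v : UT n) : Hyp n := ⟨v.1.1, v.2.1⟩

/-- The antipodal map `v ↦ -v`. -/
def flip {n : ℕ} (v : UT n) : UT n :=
  ⟨(v.1.1, -v.1.2), v.2.1, by
    have h := v.2.2.1
    simp only [mink, Prod.snd_neg, Prod.fst_neg, inner_neg_right, mul_neg] at h ⊢
    linarith, by
    have h := v.2.2.2
    simpa [mink] using h⟩

/-! ### The boundary at infinity

The boundary at infinity is the unit sphere `S^{n-1}`, which compactifies the open unit ball. -/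

theorem norm_endpoint {n : ℕ} (v : UT n) :
    ‖(v.1.1.1 + v.1.2.1)⁻¹ • (v.1.1.2 + v.1.2.2)‖ = 1 := by
  have habs := v.2.abs_lt
  have hpos : 0 < v.1.1.1 + v.1.2.1 := by linarith [(abs_lt.mp habs).1]
  obtain ⟨⟨h1, h0⟩, h2, h3⟩ := v.2
  simp only [mink] at h1 h2 h3
  have hn : ‖v.1.1.2 + v.1.2.2‖ ^ 2 = (v.1.1.1 + v.1.2.1) ^ 2 := by
    rw [norm_add_sq_real, ← real_inner_self_eq_norm_sq, ← real_inner_self_eq_norm_sq]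
    linarith
  have hn' : ‖v.1.1.2 + v.1.2.2‖ = v.1.1.1 + v.1.2.1 :=
    (sq_eq_sq₀ (norm_nonneg _) hpos.le).mp hn
  rw [norm_smul, norm_inv, Real.norm_eq_abs, abs_of_pos hpos, hn']
  exact inv_mul_cancel₀ hpos.ne'

/-- The positive endpoint `v₊ = v(+∞)` in `S^{n-1}`. -/
def posEnd {n : ℕ} (v : UT n) : Sph n :=
  ⟨(v.1.1.1 + v.1.2.1)⁻¹ • (v.1.1.2 + v.1.2.2), by
    rw [mem_sphere_zero_iff_norm]; exact norm_endpoint v⟩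

/-- The negative endpoint `v₋ = v(-∞)` in `S^{n-1}`. -/
def negEnd {n : ℕ} (v : UT n) : Sph n := posEnd (flip v)

/-- The position of a point of `ℍⁿ` in the (Poincaré) unit ball model. -/
def ballPoint {n : ℕ} (x : Hyp n) : Euc n := (1 + x.1.1)⁻¹ • x.1.2

/-- `v₊` is the limit of the geodesic `v(s)` in the closed unit ball as `s → +∞`. -/
theorem tendsto_ballPoint_geod {n : ℕ} (v : UT n) :
    Tendsto (fun s => ballPoint (geod v s)) atTop (𝓝 (posEnd v : Euc n)) := by
  have habs := v.2.abs_lt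
  have hpos : 0 < v.1.1.1 + v.1.2.1 := by linarith [(abs_lt.mp habs).1]
  have he : Tendsto (fun s : ℝ => Real.exp (-s)) atTop (𝓝 0) := Real.tendsto_exp_neg_atTop_nhds_zero
  have key : ∀ s : ℝ, ballPoint (geod v s) =
      (2 * Real.exp (-s) + ((1 + Real.exp (-s) ^ 2) * v.1.1.1 +
        (1 - Real.exp (-s) ^ 2) * v.1.2.1))⁻¹ •
        ((1 + Real.exp (-s) ^ 2) • v.1.1.2 + (1 - Real.exp (-s) ^ 2) • v.1.2.2) := by
    intro s
    have hx : 2 * Real.exp (-s) ≠ 0 := by positivity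
    have hm : Real.exp s * Real.exp (-s) = 1 := by rw [← Real.exp_add]; simp
    have hc : 2 * Real.exp (-s) * Real.cosh s = 1 + Real.exp (-s) ^ 2 := by
      rw [Real.cosh_eq]; linear_combination hm
    have hs : 2 * Real.exp (-s) * Real.sinh s = 1 - Real.exp (-s) ^ 2 := by
      rw [Real.sinh_eq]; linear_combination hm
    rw [← hc, ← hs]
    simp only [ballPoint, geod, Prod.fst_add, Prod.snd_add, Prod.smul_fst, Prod.smul_snd,
      smul_eq_mul]
    rw [mul_smul (2 * Real.exp (-s)), mul_smul (2 * Real.exp (-s)), ← smul_add, smul_smul]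
    congr 1
    rw [show 2 * Real.exp (-s) + (2 * Real.exp (-s) * Real.cosh s * v.1.1.1 +
      2 * Real.exp (-s) * Real.sinh s * v.1.2.1) = 2 * Real.exp (-s) *
      (1 + (Real.cosh s * v.1.1.1 + Real.sinh s * v.1.2.1)) by ring, mul_inv, mul_right_comm,
      inv_mul_cancel₀ hx, one_mul]
  simp_rw [key]
  have hlim : Tendsto (fun e : ℝ => (2 * e + ((1 + e ^ 2) * v.1.1.1 + (1 - e ^ 2) * v.1.2.1))⁻¹ •
        ((1 + e ^ 2) • v.1.1.2 + (1 - e ^ 2) • v.1.2.2)) (𝓝 0) (𝓝 (posEnd v : Euc n)) := by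
    have hcont : ContinuousAt (fun e : ℝ =>
        (2 * e + ((1 + e ^ 2) * v.1.1.1 + (1 - e ^ 2) * v.1.2.1))⁻¹ •
        ((1 + e ^ 2) • v.1.1.2 + (1 - e ^ 2) • v.1.2.2)) 0 := by
      refine ContinuousAt.fun_smul (ContinuousAt.fun_inv₀ (by fun_prop) ?_) (by fun_prop)
      simpa using hpos.ne'
    have := hcont.tendsto
    simpa [posEnd] using this
  exact hlim.comp he

/-- The unit tangent vector at the origin pointing to `ξ`. -/
def originDir {n : ℕ} (ξ : Sph n) : UT n :=
  ⟨((1, 0), (0, ξ)), by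
    have h : ‖(ξ : Euc n)‖ = 1 := by simp
    refine ⟨by simp [IsHyp, mink], by simp [mink], ?_⟩
    simp [mink, h]⟩

/-- The geodesic ray from the origin with point at infinity `ξ`. -/
def ray {n : ℕ} (ξ : Sph n) (t : ℝ) : Hyp n := geod (originDir ξ) t

/-- The Busemann cocycle `β_ξ(x, y) = lim_{t → ∞} d(ρ_t, x) - d(ρ_t, y)`. -/
def busemann {n : ℕ} (ξ : Sph n) (x y : Hyp n) : ℝ :=
  limUnder atTop fun t : ℝ => hdist (ray ξ t) x - hdist (ray ξ t) y

/-- The visual distance between `ξ` and `η` seen from `x`. -/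
def visualDist {n : ℕ} (x : Hyp n) (ξ η : Sph n) : ℝ :=
  limUnder atTop fun t : ℝ => Real.exp
    (-(1 / 2) * (hdist x (ray ξ t) + hdist x (ray η t) - hdist (ray ξ t) (ray η t)))

/-! ### Isometries and quotients -/

/-- The isometry group of `ℍⁿ`, i.e. the group `O⁺(n, 1)` of the linear automorphisms of Minkowski
space that preserve the Minkowski form and the upper sheet of the hyperboloid. -/
def isom (n : ℕ) : Subgroup (Mink n ≃ₗ[ℝ] Mink n) where
  carrier := {g | (∀ v w, mink (g v) (g w) = mink v w) ∧ ∀ v, IsHyp (g v) ↔ IsHyp v}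
  mul_mem' := by
    rintro a b ⟨ha, ha'⟩ ⟨hb, hb'⟩
    exact ⟨fun v w => by simp [ha, hb], fun v => by simp [ha', hb']⟩
  one_mem' := ⟨fun _ _ => rfl, fun _ => Iff.rfl⟩
  inv_mem' := by
    rintro a ⟨ha, ha'⟩
    refine ⟨fun v w => ?_, fun v => ?_⟩
    · have := ha (a⁻¹ v) (a⁻¹ w)
      rw [← LinearEquiv.mul_apply, ← LinearEquiv.mul_apply, mul_inv_cancel] at this
      exact this.symm
    · have := ha' (a⁻¹ v)
      rw [← LinearEquiv.mul_apply, mul_inv_cancel] at this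
      exact this.symm

instance (n : ℕ) : MulAction (isom n) (Hyp n) where
  smul g x := ⟨g.1 x.1, (g.2.2 x.1).2 x.2⟩
  one_smul _ := rfl
  mul_smul _ _ _ := rfl

/-- The action on the unit tangent bundle by the tangent maps. -/
instance (n : ℕ) : MulAction (isom n) (UT n) where
  smul g v := ⟨(g.1 v.1.1, g.1 v.1.2), (g.2.2 v.1.1).2 v.2.1,
    (g.2.1 _ _).trans v.2.2.1, (g.2.1 _ _).trans v.2.2.2⟩
  one_smul _ := rfl
  mul_smul _ _ _ := rfl

/-- The quotient space `Γ\X` (with the quotient `σ`-algebra). For `X = ℍⁿ` it is the hyperbolic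
manifold `M`, and for `X = T¹ℍⁿ` it is `T¹M`. -/
abbrev Quo {n : ℕ} (Γ : Subgroup (isom n)) (X : Type) [MulAction (isom n) X] : Type :=
  MulAction.orbitRel.Quotient Γ X

/-- The measure induced on `Γ\X` by a `Γ`-invariant measure `m` on `X`: the smallest measure that
is at least the image of `m|_A` for each measurable `A` which the projection maps injectively to
`Γ\X`. If the action is free and `F` is a measurable strict fundamental domain, this is the image
of `m|_F`. -/
def quoMeasure {n : ℕ} (Γ : Subgroup (isom n)) {X : Type} [MulAction (isom n) X]
    [MeasurableSpace X] (m : Measure X) : Measure (Quo Γ X) :=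
  ⨆ (A : Set X) (_ : MeasurableSet A)
    (_ : Set.InjOn (Quotient.mk'' : X → Quo Γ X) A), (m.restrict A).map Quotient.mk''

/-- The critical exponent of `Γ`. -/
def criticalExponent {n : ℕ} (Γ : Subgroup (isom n)) (x₀ : Hyp n) : ℝ :=
  limUnder atTop fun k : ℕ => (1 / (k : ℝ)) * Real.log (Nat.card {γ : Γ // hdist x₀ (γ • x₀) ≤ k})

/-! ### The Riemannian measure and the Liouville measure -/

/-- The global chart `ℝⁿ → ℍⁿ` by vertical projection, with values in Minkowski space. -/
def chartMap {n : ℕ} (p : Euc n) : Mink n := (Real.sqrt (1 + ‖p‖ ^ 2), p)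

theorem isHyp_chartMap {n : ℕ} (p : Euc n) : IsHyp (chartMap p) := by
  have h : 0 < 1 + ‖p‖ ^ 2 := by positivity
  refine ⟨?_, Real.sqrt_pos.2 h⟩
  simp only [mink, chartMap, Real.mul_self_sqrt h.le, real_inner_self_eq_norm_sq]
  ring

/-- The global chart `ℝⁿ → ℍⁿ`. -/
def chart {n : ℕ} (p : Euc n) : Hyp n := ⟨chartMap p, isHyp_chartMap p⟩

/-- The matrix of the Riemannian metric (the restriction of the Minkowski form to the tangent
spaces of the hyperboloid) in the global chart. -/
def metricMatrix {n : ℕ} (p : Euc n) : Matrix (Fin n) (Fin n) ℝ :=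
  Matrix.of fun i j => mink (fderiv ℝ chartMap p (EuclideanSpace.single i 1))
    (fderiv ℝ chartMap p (EuclideanSpace.single j 1))

/-- The Riemannian measure of `ℍⁿ`: the density `√(det g)` in the global chart. -/
def volHyp (n : ℕ) : Measure (Hyp n) :=
  ((volume : Measure (Euc n)).withDensity
    fun p => ENNReal.ofReal (Real.sqrt (metricMatrix p).det)).map chart

/-- The spherical (Lebesgue) measure of `S^{n-1}`. -/
def sphMeasure (n : ℕ) : Measure (Sph n) := (volume : Measure (Euc n)).toSphere

/-- A linear isometry from `ℝⁿ` onto the tangent space `T_xℍⁿ` (the boost from the origin). -/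
def frame {n : ℕ} (x : Hyp n) (w : Euc n) : Mink n :=
  (⟪x.1.2, w⟫, w + (⟪x.1.2, w⟫ / (1 + x.1.1)) • x.1.2)

theorem isUnitTangent_frame {n : ℕ} (x : Hyp n) (w : Sph n) :
    IsUnitTangent (x.1, frame x w) := by
  obtain ⟨h1, h0⟩ := x.2
  have hw : ⟪(w : Euc n), (w : Euc n)⟫ = 1 := by
    rw [real_inner_self_eq_norm_sq]; simp
  have hne : 1 + x.1.1 ≠ 0 := by linarith
  have hc := real_inner_comm x.1.2 (w : Euc n)
  simp only [mink] at h1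
  have e1 : ⟪x.1.2, x.1.2⟫ = x.1.1 * x.1.1 - 1 := by linarith
  refine ⟨x.2, ?_, ?_⟩
  · simp only [mink, frame, inner_add_right, real_inner_smul_right, e1]
    field_simp
    ring
  · simp only [mink, frame, inner_add_right, inner_add_left, real_inner_smul_right,
      real_inner_smul_left, e1, hw, hc]
    field_simp
    ring

/-- The point `(x, frame x w)` of the unit tangent bundle. -/
def frameUT {n : ℕ} (p : Hyp n × Sph n) : UT n := ⟨(p.1.1, frame p.1 p.2), isUnitTangent_frame _ _⟩

/-- The Liouville measure of `T¹ℍⁿ`: it disintegrates over the Riemannian measure of `ℍⁿ`, with the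
spherical measure of the unit sphere `T¹_xℍⁿ` as the measure on the fibre above `x`. -/
def liouvilleCover (n : ℕ) : Measure (UT n) := ((volHyp n).prod (sphMeasure n)).map frameUT

/-! ### The Bowen-Margulis measure -/

/-- The spherical density: `μ_0` is the Lebesgue measure of `S^{n-1}`, where `0` is the origin, and
`dμ_x/dμ_0(ξ) = exp(-(n-1) β_ξ(x, 0))`. -/
def sphericalDensity (n : ℕ) (x : Hyp n) : Measure (Sph n) :=
  (sphMeasure n).withDensity fun ξ =>
    ENNReal.ofReal (Real.exp (-((n : ℝ) - 1) * busemann ξ x (origin n)))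

/-- `t` is the signed distance of `π(v)` from the closest point to `x₀` on the geodesic line
defined by `v`, i.e. this closest point is `v(-t)`. -/
def IsHopfTime {n : ℕ} (x₀ : Hyp n) (v : UT n) (t : ℝ) : Prop :=
  ∀ s, hdist x₀ (geod v (-t)) ≤ hdist x₀ (geod v s)

/-- The time coordinate of Hopf's parametrisation with respect to `x₀`. -/
def hopfTime {n : ℕ} (x₀ : Hyp n) (v : UT n) : ℝ := Classical.epsilon (IsHopfTime x₀ v)

/-- Hopf's parametrisation `v ↦ (v₋, v₊, t)`. -/
def hopf {n : ℕ} (x₀ : Hyp n) (v : UT n) : Sph n × Sph n × ℝ :=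
  (negEnd v, posEnd v, hopfTime x₀ v)

/-- The Bowen-Margulis measure on `T¹ℍⁿ` for `Γ` built from a family `(μ_x)` of measures on the
boundary at infinity: in Hopf's parametrisation it is
`d_{x₀}(v₋, v₊)^(-2δ) dμ_{x₀}(v₋) dμ_{x₀}(v₊) dt`, where `δ` is the critical exponent of `Γ`. -/
def bowenMargulisCover {n : ℕ} (Γ : Subgroup (isom n)) (μ : Hyp n → Measure (Sph n))
    (x₀ : Hyp n) : Measure (UT n) :=
  (((μ x₀).prod ((μ x₀).prod (volume : Measure ℝ))).withDensity fun p =>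
    ENNReal.ofReal (visualDist x₀ p.1 p.2.1 ^ (-(2 * criticalExponent Γ x₀)))).comap (hopf x₀)

/-! ### The measures of the quotient manifold `M = Γ\ℍⁿ` -/

/-- The Riemannian measure of `M = Γ\ℍⁿ`. -/
def volM {n : ℕ} (Γ : Subgroup (isom n)) : Measure (Quo Γ (Hyp n)) := quoMeasure Γ (volHyp n)

/-- The Liouville measure of `T¹M = Γ\T¹ℍⁿ`. -/
def liouvilleM {n : ℕ} (Γ : Subgroup (isom n)) : Measure (Quo Γ (UT n)) :=
  quoMeasure Γ (liouvilleCover n)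

/-- The Bowen-Margulis measure of `T¹M = Γ\T¹ℍⁿ`, built from the spherical density. -/
def bowenMargulisM {n : ℕ} (Γ : Subgroup (isom n)) (x₀ : Hyp n) : Measure (Quo Γ (UT n)) :=
  quoMeasure Γ (bowenMargulisCover Γ (sphericalDensity n) x₀)

end HypBM

end

open MeasureTheory Filter Topology
open scoped RealInnerProductSpace

noncomputable section

namespace HypBM

variable {n : ℕ}

/-! ### The Minkowski form and the hyperbolic distance -/

/-! In Minkowski space a unit tangent vector (x, u) splits into two null vectors, x + u and x - u,
which are positive multiples of (1, v₊) and (1, v₋). Put h(ξ) = -⟨x₀, (1, ξ)⟩ (`height`). Then exp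
β_ξ(x₀, 0) = h(ξ) and d_{x₀}(ξ, η)² = (1 - ⟪ξ, η⟫) / (2 h(ξ) h(η)) (`busemann_eq`, `visualDist_eq`).
Once δ = n - 1, all heights cancel in the Bowen-Margulis density, leaving (2 / (1 - ⟪ξ, η⟫))^(n-1)
dη dξ dt, which is independent of x₀ (`poissonKernel_mul_visualKernel`).

The Liouville measure is (1 - ⟪ξ, η⟫)^(-(n-1)) dη dξ dt in the same coordinates
(`lintegral_liouvilleCover_hopf`), whence the factor 2^(n-1). To see this, replace the unit vector
at x by its positive endpoint ξ, at the cost of the Jacobian h_x(ξ)^(-(n-1)), where h_x(ξ) = -⟨x,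
(1, ξ)⟩ (`lintegral_posEnd_frameUT`). For fixed ξ, project ℍⁿ along (1, ξ) onto the light cone,
which turns the hyperbolic volume into the invariant measure dq/‖q‖ (`lintegral_volHyp_horo`). With
q = rη the height is r(1 - ⟪ξ, η⟫), the powers of r combine to dr/r, and Hopf's time is -log r plus
a constant. All Jacobians come from one change of variables for shears (`lintegral_image_shear`).

The equality δ = n - 1 comes from averaging orbit counts over a fundamental domain of finite volume
and comparing with the volumes of balls, which grow like exp((n-1)r) (`criticalExponent_eq`).
Finally, both measures descend to the quotient as images of their restrictions to one strict
fundamental domain (`exists_strict_fundamentalDomain`, `quoMeasure_eq`). -/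

theorem mink_comm (v w : Mink n) : mink v w = mink w v := by
  simp only [mink, real_inner_comm, mul_comm]

theorem mink_add_left (u v w : Mink n) : mink (u + v) w = mink u w + mink v w := by
  simp only [mink, Prod.snd_add, Prod.fst_add, inner_add_left]; ring

theorem mink_add_right (u v w : Mink n) : mink u (v + w) = mink u v + mink u w := by
  simp only [mink, Prod.snd_add, Prod.fst_add, inner_add_right]; ring

theorem mink_smul_left (c : ℝ) (v w : Mink n) : mink (c • v) w = c * mink v w := by
  simp only [mink, Prod.smul_snd, Prod.smul_fst, real_inner_smul_left, smul_eq_mul]; ring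

theorem mink_smul_right (c : ℝ) (v w : Mink n) : mink v (c • w) = c * mink v w := by
  simp only [mink, Prod.smul_snd, Prod.smul_fst, real_inner_smul_right, smul_eq_mul]; ring

theorem Hyp.fst_pos (x : Hyp n) : 0 < x.1.1 := x.2.2

theorem Hyp.norm_sq (x : Hyp n) : ‖x.1.2‖ ^ 2 = x.1.1 ^ 2 - 1 := by
  have h := x.2.1
  simp only [mink, real_inner_self_eq_norm_sq] at h
  linarith

theorem Hyp.inner_self (x : Hyp n) : ⟪x.1.2, x.1.2⟫ = x.1.1 ^ 2 - 1 := by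
  rw [real_inner_self_eq_norm_sq, x.norm_sq]

theorem Hyp.norm_lt (x : Hyp n) : ‖x.1.2‖ < x.1.1 :=
  lt_of_pow_lt_pow_left₀ 2 x.fst_pos.le (by rw [x.norm_sq]; linarith)

/-- Reversed Cauchy-Schwarz inequality on the upper sheet. It keeps the argument of `Real.arcosh` in
its domain, so distances can be handled through their cosh. -/
theorem one_le_neg_mink (x y : Hyp n) : 1 ≤ -mink x.1 y.1 := by
  have h := real_inner_le_norm x.1.2 y.1.2
  have hx := x.norm_sq
  have hy := y.norm_sq
  have hx0 := x.norm_lt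
  have hy0 := y.norm_lt
  have := norm_nonneg x.1.2
  have := norm_nonneg y.1.2
  have key : ‖x.1.2‖ * ‖y.1.2‖ + 1 ≤ x.1.1 * y.1.1 := by
    apply le_of_sq_le_sq _ (mul_nonneg x.fst_pos.le y.fst_pos.le)
    nlinarith [sq_nonneg (‖x.1.2‖ - ‖y.1.2‖)]
  simp only [mink]
  linarith

theorem cosh_hdist (x y : Hyp n) : Real.cosh (hdist x y) = -mink x.1 y.1 :=
  Real.cosh_arcosh (one_le_neg_mink x y)

theorem hdist_nonneg (x y : Hyp n) : 0 ≤ hdist x y := Real.arcosh_nonneg (one_le_neg_mink x y)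

theorem hdist_comm (x y : Hyp n) : hdist x y = hdist y x := by rw [hdist, hdist, mink_comm]

theorem hdist_le_iff (x y : Hyp n) {r : ℝ} (hr : 0 ≤ r) :
    hdist x y ≤ r ↔ -mink x.1 y.1 ≤ Real.cosh r := by
  rw [← cosh_hdist, Real.cosh_le_cosh, abs_of_nonneg (hdist_nonneg x y), abs_of_nonneg hr]

theorem isom_mink (g : isom n) (v w : Mink n) : mink (g.1 v) (g.1 w) = mink v w := g.2.1 v w

theorem smul_hyp_coe (g : isom n) (x : Hyp n) : (g • x).1 = g.1 x.1 := rfl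

theorem hdist_smul (g : isom n) (x y : Hyp n) : hdist (g • x) (g • y) = hdist x y := by
  simp only [hdist, smul_hyp_coe, isom_mink]

/-! ### Boosts -/

/-- The point reflection of a point of `ℍⁿ` in the origin. -/
def Hyp.inv (x : Hyp n) : Hyp n := ⟨(x.1.1, -x.1.2), by
  have := x.2
  simpa [IsHyp, mink] using this⟩

/-- The boost that maps the origin to `x`, as a linear map. -/
def boostLin (x : Hyp n) : Mink n →ₗ[ℝ] Mink n where
  toFun v := v.1 • x.1 + frame x v.2
  map_add' v w := by
    ext1
    · simp [frame, inner_add_right]; ring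
    · simp only [frame, Prod.snd_add, Prod.fst_add, Prod.smul_snd, inner_add_right]; module
  map_smul' c v := by
    ext1
    · simp [frame, real_inner_smul_right]; ring
    · simp only [frame, Prod.smul_snd, Prod.smul_fst, Prod.snd_add, real_inner_smul_right,
        smul_eq_mul, RingHom.id_apply]
      module

theorem boostLin_fst (x : Hyp n) (v : Mink n) :
    (boostLin x v).1 = x.1.1 * v.1 + ⟪x.1.2, v.2⟫ := by
  simp [boostLin, frame, mul_comm]

theorem boostLin_snd (x : Hyp n) (v : Mink n) :
    (boostLin x v).2 = v.2 + (v.1 + ⟪x.1.2, v.2⟫ / (1 + x.1.1)) • x.1.2 := by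
  simp only [boostLin, frame, LinearMap.coe_mk, AddHom.coe_mk, Prod.snd_add, Prod.smul_snd]
  module

theorem mink_boostLin (x : Hyp n) (v w : Mink n) :
    mink (boostLin x v) (boostLin x w) = mink v w := by
  have h1 : 1 + x.1.1 ≠ 0 := by linarith [x.fst_pos]
  have h2 := x.inner_self
  simp only [mink, boostLin_fst, boostLin_snd, inner_add_left, inner_add_right,
    real_inner_smul_left, real_inner_smul_right, h2, real_inner_comm x.1.2 v.2]
  field_simp
  ring

theorem boostLin_inv (x : Hyp n) (v : Mink n) : boostLin x (boostLin x.inv v) = v := by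
  have h1 : 1 + x.1.1 ≠ 0 := by linarith [x.fst_pos]
  have h2 := x.inner_self
  ext1
  · simp only [boostLin_fst, boostLin_snd, Hyp.inv, inner_add_right, inner_neg_left,
      real_inner_smul_right, inner_neg_right, h2]
    field_simp
    ring
  · simp only [boostLin_fst, boostLin_snd, Hyp.inv, inner_add_right, inner_neg_left,
      real_inner_smul_right, inner_neg_right, h2, smul_neg]
    rw [add_assoc, ← sub_eq_neg_add, ← sub_smul]
    simp only [add_eq_left]
    convert zero_smul ℝ _
    field_simp
    ring

theorem Hyp.inv_inv (x : Hyp n) : x.inv.inv = x := by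
  apply Subtype.ext; simp [Hyp.inv]

theorem isHyp_boostLin (x : Hyp n) {v : Mink n} (hv : IsHyp v) : IsHyp (boostLin x v) := by
  refine ⟨by rw [mink_boostLin]; exact hv.1, ?_⟩
  -- The time coordinate of the boosted vector is -⟨x.inv, v⟩, which the reversed Cauchy-Schwarz
  -- inequality bounds below by 1.
  have := one_le_neg_mink x.inv ⟨v, hv⟩
  simp only [mink, Hyp.inv, inner_neg_left] at this
  rw [boostLin_fst]
  linarith

/-- The boost that maps the origin to `x`, as an isometry of `ℍⁿ`. -/
def boost (x : Hyp n) : isom n :=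
  ⟨LinearEquiv.ofLinearMap (boostLin x) (boostLin x.inv)
    (LinearMap.ext fun v => boostLin_inv x v)
    (LinearMap.ext fun v => by simpa [Hyp.inv_inv] using boostLin_inv x.inv v), by
    refine ⟨mink_boostLin x, fun v => ⟨fun h => ?_, fun h => isHyp_boostLin x h⟩⟩
    have := isHyp_boostLin x.inv h
    have e := boostLin_inv x.inv v
    rw [Hyp.inv_inv] at e
    simpa [e] using this⟩

theorem boost_apply (x : Hyp n) (v : Mink n) : (boost x).1 v = boostLin x v := rfl

theorem boost_smul_origin (x : Hyp n) : boost x • origin n = x := by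
  apply Subtype.ext
  simp [smul_hyp_coe, boost_apply, boostLin, origin, frame]

/-- A boost moves the middle point to the origin. There the time coordinate and the norm of the
space part are the cosh and sinh of the distance to the origin, so the claim is Cauchy-Schwarz
together with the addition formula for cosh. -/
theorem hdist_triangle (x y z : Hyp n) : hdist x z ≤ hdist x y + hdist y z := by
  have key : ∀ x z : Hyp n, hdist x z ≤ hdist x (origin n) + hdist (origin n) z := by
    intro x z
    have hc : ∀ x : Hyp n, Real.cosh (hdist (origin n) x) = x.1.1 := fun x => by
      rw [cosh_hdist]; simp [mink, origin]
    have hs : ∀ x : Hyp n, Real.sinh (hdist (origin n) x) = ‖x.1.2‖ := fun x => by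
      rw [← sq_eq_sq₀ (Real.sinh_nonneg_iff.2 (hdist_nonneg _ _)) (norm_nonneg _), Real.sinh_sq,
        hc, x.norm_sq]
    have hnn := add_nonneg (hdist_nonneg x (origin n)) (hdist_nonneg (origin n) z)
    rw [hdist_le_iff _ _ hnn, hdist_comm x, Real.cosh_add, hc, hs, hc, hs]
    have := neg_le_of_abs_le (abs_real_inner_le_norm x.1.2 z.1.2)
    simp only [mink]
    linarith
  have e : ∀ x, hdist ((boost y)⁻¹ • x) (origin n) = hdist x y := fun x => by
    rw [← hdist_smul (boost y), smul_inv_smul, boost_smul_origin]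
  have h := key ((boost y)⁻¹ • x) ((boost y)⁻¹ • z)
  rwa [hdist_smul, hdist_comm (origin n), e, e, hdist_comm z] at h

/-! ### Isometries that fix the origin -/

theorem isom_apply_snd_of_fix {g : isom n} (hg : g • origin n = origin n) (v : Mink n) :
    (g.1 v).1 = v.1 := by
  have h0 : g.1 (1, 0) = (1, 0) := congrArg Subtype.val hg
  have h := isom_mink g v (1, 0)
  rw [h0] at h
  simpa [mink] using h

/-- The orthogonal transformation of `ℝⁿ` given by an isometry that fixes the origin. -/
def rotation (g : isom n) (hg : g • origin n = origin n) : Euc n ≃ₗᵢ[ℝ] Euc n :=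
  LinearIsometry.toLinearIsometryEquiv
    { toFun := fun w => (g.1 (0, w)).2
      map_add' := fun v w => by rw [← Prod.snd_add, ← map_add]; simp
      map_smul' := fun c w => by
        rw [RingHom.id_apply, ← Prod.smul_snd, ← map_smul]; simp
      norm_map' := fun w => by
        have h := isom_mink g (0, w) (0, w)
        have h1 := isom_apply_snd_of_fix hg (0, w)
        simp only [mink, h1, real_inner_self_eq_norm_sq, mul_zero, sub_zero] at h
        exact (sq_eq_sq₀ (norm_nonneg _) (norm_nonneg _)).1 h } rfl

theorem isom_apply_of_fix {g : isom n} (hg : g • origin n = origin n) (v : Mink n) :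
    g.1 v = (v.1, rotation g hg v.2) := by
  ext1
  · exact isom_apply_snd_of_fix hg v
  · have h0 : g.1 (1, 0) = (1, 0) := congrArg Subtype.val hg
    have : v = v.1 • ((1, 0) : Mink n) + (0, v.2) := by ext1 <;> simp
    conv_lhs => rw [this, map_add, map_smul, h0]
    simp only [Prod.snd_add, Prod.smul_snd, smul_zero, zero_add]
    rfl

/-! ### The Riemannian measure in the global chart -/

/-- The time coordinate of the point of `ℍⁿ` above `p`. -/
def massShell (p : Euc n) : ℝ := Real.sqrt (1 + ‖p‖ ^ 2)

theorem massShell_pos (p : Euc n) : 0 < massShell p := Real.sqrt_pos.2 (by positivity)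

theorem massShell_sq (p : Euc n) : massShell p ^ 2 = 1 + ‖p‖ ^ 2 := Real.sq_sqrt (by positivity)

theorem chart_fst (p : Euc n) : (chart p).1.1 = massShell p := rfl

theorem chart_snd (p : Euc n) : (chart p).1.2 = p := rfl

theorem chart_coord (x : Hyp n) : chart x.1.2 = x := by
  apply Subtype.ext
  ext1
  · show Real.sqrt (1 + ‖x.1.2‖ ^ 2) = _
    rw [x.norm_sq, add_sub_cancel, Real.sqrt_sq x.fst_pos.le]
  · rfl

theorem hasFDerivAt_massShell (p : Euc n) :
    HasFDerivAt massShell ((massShell p)⁻¹ • innerSL ℝ p) p := by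
  have h1 : HasFDerivAt (fun p : Euc n => 1 + ‖p‖ ^ 2) (2 • innerSL ℝ p) p :=
    (hasStrictFDerivAt_norm_sq p).hasFDerivAt.const_add 1
  refine (h1.sqrt (by positivity)).congr_fderiv ?_
  ext w
  simp only [smul_apply, smul_eq_mul, nsmul_eq_mul, massShell]
  have : Real.sqrt (1 + ‖p‖ ^ 2) ≠ 0 := (massShell_pos p).ne'
  field_simp
  simp

/-- This is the coefficient of the shear by which a boost acts on space parts: ψ is `massShell` on
the hyperboloid and the norm on the light cone. -/
theorem hasFDerivAt_add_inner_div {ψ : Euc n → ℝ} {ψ' : Euc n →L[ℝ] ℝ} {p : Euc n}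
    (h : HasFDerivAt ψ ψ' p) (a : Euc n) (c : ℝ) :
    HasFDerivAt (fun p => ψ p + ⟪a, p⟫ / c) (ψ' + c⁻¹ • innerSL ℝ a) p := by
  have e : (fun p => ψ p + ⟪a, p⟫ / c) = fun p => ψ p + (c⁻¹ • innerSL ℝ a) p := by
    funext q; simp [div_eq_inv_mul]
  rw [e]
  exact h.add (c⁻¹ • innerSL ℝ a).hasFDerivAt

theorem fderiv_chartMap (p w : Euc n) :
    fderiv ℝ chartMap p w = ((massShell p)⁻¹ * ⟪p, w⟫, w) := by
  have h : HasFDerivAt chartMap (((massShell p)⁻¹ • innerSL ℝ p).prod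
      (ContinuousLinearMap.id ℝ (Euc n))) p :=
    (hasFDerivAt_massShell p).prodMk (hasFDerivAt_id p)
  rw [h.fderiv]
  simp

/-- The metric is the identity minus the rank-one matrix p pᵀ / (1 + ‖p‖²), so the matrix
determinant lemma applies. The Riemannian measure is therefore dp / `massShell p`. -/
theorem det_metricMatrix (p : Euc n) : (metricMatrix p).det = (massShell p ^ 2)⁻¹ := by
  have h : metricMatrix p = 1 + Matrix.replicateCol Unit (fun i => -((massShell p ^ 2)⁻¹ * p i)) *
      Matrix.replicateRow Unit (fun i => p i) := by
    ext i j
    simp only [metricMatrix, Matrix.of_apply, fderiv_chartMap, mink, Matrix.add_apply,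
      Matrix.mul_apply, Matrix.one_apply, Matrix.replicateCol_apply, Matrix.replicateRow_apply,
      EuclideanSpace.inner_single_right]
    simp [eq_comm]
    ring
  have hs : ∑ i, p i * p i = ‖p‖ ^ 2 := by
    rw [EuclideanSpace.norm_sq_eq]; simp [sq]
  rw [h, Matrix.det_one_add_replicateCol_mul_replicateRow]
  have e : (fun i => p i) ⬝ᵥ (fun i => -((massShell p ^ 2)⁻¹ * p i)) =
      -((massShell p ^ 2)⁻¹ * ‖p‖ ^ 2) := by
    rw [← hs, Finset.mul_sum, ← Finset.sum_neg_distrib]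
    exact Finset.sum_congr rfl fun i _ => by ring
  rw [e]
  have h1 := massShell_sq p
  have h2 := (pow_pos (massShell_pos p) 2).ne'
  rw [← mul_right_inj' h2, mul_inv_cancel₀ h2, mul_add, mul_neg, ← mul_assoc, mul_inv_cancel₀ h2]
  linarith

theorem continuous_massShell : Continuous (massShell (n := n)) := by
  unfold massShell; fun_prop

theorem continuous_chart : Continuous (chart (n := n)) :=
  Continuous.subtype_mk (continuous_massShell.prodMk continuous_id) _

theorem lintegral_volHyp {f : Hyp n → ENNReal} (hf : Measurable f) :
    ∫⁻ x, f x ∂volHyp n = ∫⁻ p : Euc n, ENNReal.ofReal (massShell p)⁻¹ * f (chart p) := by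
  have hd : ∀ p : Euc n, Real.sqrt (metricMatrix p).det = (massShell p)⁻¹ := fun p => by
    rw [det_metricMatrix, Real.sqrt_inv, Real.sqrt_sq (massShell_pos p).le]
  have hm : Measurable fun p : Euc n => ENNReal.ofReal (massShell p)⁻¹ :=
    continuous_massShell.measurable.inv.ennreal_ofReal
  unfold volHyp
  simp_rw [hd]
  rw [lintegral_map hf continuous_chart.measurable,
    lintegral_withDensity_eq_lintegral_mul _ hm
      (show Measurable fun p => f (chart p) from hf.comp continuous_chart.measurable)]
  rfl

/-! ### Change of variables for shears -/

/-- The derivative is a transvection, of determinant 1 + φ'(a). When this is the ratio of the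
energies after and before, dp/E is carried to dq/E'. The lemma serves three times: hyperboloid to
hyperboloid, cone to cone, and hyperboloid to cone. -/
theorem lintegral_image_shear {φ : Euc n → ℝ} {φ' : Euc n → Euc n →L[ℝ] ℝ} {a : Euc n}
    {s : Set (Euc n)} (hs : MeasurableSet s) (hφ : ∀ p ∈ s, HasFDerivAt φ (φ' p) p)
    (hinj : Set.InjOn (fun p => p + φ p • a) s) {E E' : Euc n → ℝ} (hE : ∀ p ∈ s, 0 < E p)
    (hE' : ∀ p ∈ s, 0 < E' (p + φ p • a))
    (hdet : ∀ p ∈ s, 1 + φ' p a = E' (p + φ p • a) / E p) (g : Euc n → ENNReal) :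
    ∫⁻ q in (fun p => p + φ p • a) '' s, ENNReal.ofReal (E' q)⁻¹ * g q =
      ∫⁻ p in s, ENNReal.ofReal (E p)⁻¹ * g (p + φ p • a) := by
  have hd : ∀ p ∈ s, HasFDerivWithinAt (fun p => p + φ p • a)
      (ContinuousLinearMap.id ℝ (Euc n) + (φ' p).smulRight a) s p := fun p hp =>
    ((hasFDerivAt_id p).add ((hφ p hp).smul_const a)).hasFDerivWithinAt
  rw [lintegral_image_eq_lintegral_abs_det_fderiv_mul volume hs hd hinj]
  refine setLIntegral_congr_fun hs fun p hp => ?_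
  have hdet' : (ContinuousLinearMap.id ℝ (Euc n) + (φ' p).smulRight a).det =
      E' (p + φ p • a) / E p := by
    rw [← hdet p hp]
    exact LinearMap.transvection.det (φ' p).toLinearMap a
  have h1 := hE p hp
  have h2 := hE' p hp
  simp only [hdet']
  rw [abs_of_pos (div_pos h2 h1), ← mul_assoc, ← ENNReal.ofReal_mul (div_pos h2 h1).le]
  congr 2
  field_simp

/-! ### Invariance of the Riemannian measure -/

theorem measurable_smul_hyp (g : isom n) : Measurable fun x : Hyp n => g • x := by
  have : Continuous fun x : Hyp n => g • x :=
    Continuous.subtype_mk ((LinearMap.continuous_of_finiteDimensional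
      g.1.toLinearMap).comp continuous_subtype_val) _
  exact this.measurable

theorem measurable_comp_smul_hyp {f : Hyp n → ENNReal} (hf : Measurable f) (g : isom n) :
    Measurable fun x : Hyp n => f (g • x) := hf.comp (measurable_smul_hyp g)

theorem lintegral_volHyp_boost (x : Hyp n) {f : Hyp n → ENNReal} (hf : Measurable f) :
    ∫⁻ y, f (boost x • y) ∂volHyp n = ∫⁻ y, f y ∂volHyp n := by
  have e : ∀ p : Euc n, boost x • chart p =
      chart (p + (massShell p + ⟪x.1.2, p⟫ / (1 + x.1.1)) • x.1.2) := fun p => by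
    rw [← chart_coord (boost x • chart p)]
    congr 1
    rw [smul_hyp_coe, boost_apply, boostLin_snd]
    rfl
  have hT : ∀ p : Euc n, massShell (p + (massShell p + ⟪x.1.2, p⟫ / (1 + x.1.1)) • x.1.2) =
      x.1.1 * massShell p + ⟪x.1.2, p⟫ := fun p => by
    rw [← chart_fst, ← e, smul_hyp_coe, boost_apply, boostLin_fst]; rfl
  have hchart : Function.Injective (chart (n := n)) := fun p q h =>
    congrArg (fun z : Hyp n => z.1.2) h
  have hinj : Function.Injective
      (fun p : Euc n => p + (massShell p + ⟪x.1.2, p⟫ / (1 + x.1.1)) • x.1.2) := fun p q h => by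
    apply hchart
    apply MulAction.injective (boost x)
    simp only [e]
    exact congrArg chart h
  have hsurj : Function.Surjective
      (fun p : Euc n => p + (massShell p + ⟪x.1.2, p⟫ / (1 + x.1.1)) • x.1.2) := fun q => by
    refine ⟨((boost x)⁻¹ • chart q).1.2, hchart ?_⟩
    rw [← e, chart_coord, smul_inv_smul]
  have hφ : ∀ p ∈ (Set.univ : Set (Euc n)), HasFDerivAt
      (fun p : Euc n => massShell p + ⟪x.1.2, p⟫ / (1 + x.1.1))
      ((massShell p)⁻¹ • innerSL ℝ p + (1 + x.1.1)⁻¹ • innerSL ℝ x.1.2) p := fun p _ =>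
    hasFDerivAt_add_inner_div (hasFDerivAt_massShell p) _ _
  have key := lintegral_image_shear (E := massShell) (E' := massShell) MeasurableSet.univ hφ
    hinj.injOn (fun p _ => massShell_pos p) (fun p _ => massShell_pos _) (fun p _ => by
      have h1 : 1 + x.1.1 ≠ 0 := by linarith [x.fst_pos]
      have h2 := (massShell_pos p).ne'
      rw [hT]
      simp only [add_apply, smul_apply, innerSL_apply_apply,
        smul_eq_mul, x.inner_self, real_inner_comm x.1.2 p]
      field_simp
      ring) (fun p => f (chart p))
  rw [Set.image_univ, hsurj.range_eq, Measure.restrict_univ] at key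
  rw [lintegral_volHyp hf, lintegral_volHyp (measurable_comp_smul_hyp hf _), key]
  simp_rw [e]

theorem lintegral_volHyp_of_fix {g : isom n} (hg : g • origin n = origin n)
    {f : Hyp n → ENNReal} (hf : Measurable f) :
    ∫⁻ y, f (g • y) ∂volHyp n = ∫⁻ y, f y ∂volHyp n := by
  have e : ∀ p : Euc n, g • chart p = chart (rotation g hg p) := fun p => by
    rw [← chart_coord (g • chart p), smul_hyp_coe, isom_apply_of_fix hg]
    rfl
  rw [lintegral_volHyp hf, lintegral_volHyp (measurable_comp_smul_hyp hf _)]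
  have h := (rotation g hg).measurePreserving.lintegral_comp_emb
    (rotation g hg).toHomeomorph.measurableEmbedding
    (fun p => ENNReal.ofReal (massShell p)⁻¹ * f (chart p))
  rw [← h]
  simp [e, massShell]

/-- Every isometry is an isometry fixing the origin followed by a boost, so invariance of the volume
need only be checked for these two kinds. -/
theorem boost_inv_mul_fix (g : isom n) :
    ((boost (g • origin n))⁻¹ * g) • origin n = origin n := by
  rw [mul_smul, inv_smul_eq_iff, boost_smul_origin]

theorem lintegral_volHyp_smul (g : isom n) {f : Hyp n → ENNReal} (hf : Measurable f) :
    ∫⁻ y, f (g • y) ∂volHyp n = ∫⁻ y, f y ∂volHyp n := by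
  have h := lintegral_volHyp_of_fix (boost_inv_mul_fix g)
    (measurable_comp_smul_hyp hf (boost (g • origin n)))
  rw [lintegral_volHyp_boost _ hf] at h
  simpa only [mul_smul, smul_inv_smul] using h

theorem map_smul_volHyp (g : isom n) : (volHyp n).map (g • ·) = volHyp n := by
  refine Measure.ext_of_lintegral _ fun f hf => ?_
  rw [lintegral_map hf (measurable_smul_hyp g), lintegral_volHyp_smul g hf]

/-! ### Polar coordinates -/

theorem nontrivial_euc (hn : 2 ≤ n) : Nontrivial (Euc n) := by
  have : Nontrivial (Fin n) := Fin.nontrivial_iff_two_le.2 hn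
  infer_instance

/-- The weight is built in because dq/‖q‖ is the Lorentz-invariant measure of the light cone; it
lowers the radial factor r^(n-1) to r^(n-2). -/
theorem lintegral_polar (hn : 2 ≤ n) {g : Euc n → ENNReal} (hg : Measurable g) :
    ∫⁻ q, ENNReal.ofReal ‖q‖⁻¹ * g q =
      ∫⁻ η : Sph n, (∫⁻ r in Set.Ioi (0 : ℝ),
        ENNReal.ofReal (r ^ (n - 2)) * g (r • (η : Euc n))) ∂sphMeasure n := by
  have := nontrivial_euc hn
  have hf : Measurable fun q : Euc n => ENNReal.ofReal ‖q‖⁻¹ * g q :=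
    measurable_norm.inv.ennreal_ofReal.mul hg
  set f : Euc n → ENNReal := fun q => ENNReal.ofReal ‖q‖⁻¹ * g q with hfdef
  have hF : Measurable fun p : Sph n × Set.Ioi (0 : ℝ) => f (p.2.1 • (p.1 : Euc n)) :=
    hf.comp (by fun_prop)
  have hdim : Module.finrank ℝ (Euc n) = n := by simp
  calc ∫⁻ q, f q = ∫⁻ q in ({0}ᶜ : Set (Euc n)), f q := by rw [restrict_compl_singleton]
    _ = ∫⁻ q : ({0}ᶜ : Set (Euc n)), f q ∂((volume : Measure (Euc n)).comap (↑)) :=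
      (lintegral_subtype_comap (measurableSet_singleton _).compl f).symm
    _ = ∫⁻ p : Sph n × Set.Ioi (0 : ℝ), f (p.2.1 • (p.1 : Euc n))
          ∂((volume : Measure (Euc n)).toSphere.prod
            (Measure.volumeIoiPow (Module.finrank ℝ (Euc n) - 1))) := by
      rw [← (volume : Measure (Euc n)).measurePreserving_homeomorphUnitSphereProd.lintegral_comp hF]
      refine lintegral_congr fun q => ?_
      congr 1
      have : ‖(q : Euc n)‖ ≠ 0 := norm_ne_zero_iff.2 q.2
      simp [smul_smul, mul_inv_cancel₀ this]
    _ = ∫⁻ η : Sph n, (∫⁻ r : Set.Ioi (0 : ℝ), f (r.1 • (η : Euc n))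
          ∂(Measure.volumeIoiPow (n - 1))) ∂sphMeasure n := by
      rw [lintegral_prod _ hF.aemeasurable, hdim]; rfl
    _ = _ := by
      refine lintegral_congr fun η => ?_
      have hm : Measurable fun r : Set.Ioi (0 : ℝ) => f (r.1 • (η : Euc n)) :=
        hf.comp (by fun_prop)
      rw [Measure.volumeIoiPow, lintegral_withDensity_eq_lintegral_mul _ (by fun_prop) hm,
        ← lintegral_subtype_comap measurableSet_Ioi]
      refine lintegral_congr fun r => ?_
      have hr : 0 < r.1 := r.2
      have hη : ‖(η : Euc n)‖ = 1 := by simp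
      simp only [Pi.mul_apply, hfdef, norm_smul, hη, mul_one, Real.norm_eq_abs, abs_of_pos hr]
      rw [← mul_assoc, ← ENNReal.ofReal_mul (by positivity)]
      congr 2
      rw [show n - 1 = (n - 2) + 1 by omega, pow_succ]
      field_simp

/-- The radial profile that makes the integral over a ray of the light cone equal to `1`. -/
def rayProfile (n : ℕ) (s : ℝ) : ENNReal :=
  (Set.Ioo (0 : ℝ) 1).indicator (fun s => ENNReal.ofReal (s ^ (n - 2))⁻¹) s

theorem measurable_rayProfile : Measurable (rayProfile n) :=
  Measurable.indicator (by fun_prop) measurableSet_Ioo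

/-- The powers of r cancel, and the constant h^(-(n-2)) is integrated over (0, 1/h). This records
that r^(n-2) dr is homogeneous of degree n - 1. -/
theorem lintegral_rayProfile (hn : 2 ≤ n) {h : ℝ} (hh : 0 < h) :
    ∫⁻ r in Set.Ioi (0 : ℝ), ENNReal.ofReal (r ^ (n - 2)) * rayProfile n (r * h) =
      ENNReal.ofReal (h⁻¹ ^ (n - 1)) := by
  have e : ∀ r ∈ Set.Ioi (0 : ℝ), ENNReal.ofReal (r ^ (n - 2)) * rayProfile n (r * h) =
      (Set.Iio h⁻¹).indicator (fun _ => ENNReal.ofReal (h⁻¹ ^ (n - 2))) r := by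
    intro r (hr : 0 < r)
    by_cases hlt : r < h⁻¹
    · have h1 : r * h ∈ Set.Ioo (0 : ℝ) 1 := ⟨by positivity, by
        rwa [← lt_div_iff₀ hh, one_div]⟩
      rw [rayProfile, Set.indicator_of_mem h1, Set.indicator_of_mem (by exact hlt),
        ← ENNReal.ofReal_mul (by positivity)]
      congr 1
      rw [mul_pow, mul_inv, mul_inv_cancel_left₀ (by positivity), inv_pow]
    · have h1 : r * h ∉ Set.Ioo (0 : ℝ) 1 := fun hm => hlt (by
        rw [← one_div, lt_div_iff₀ hh]; exact hm.2)
      rw [rayProfile, Set.indicator_of_notMem h1, Set.indicator_of_notMem (by exact hlt), mul_zero]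
  rw [setLIntegral_congr_fun measurableSet_Ioi e, lintegral_indicator_const measurableSet_Iio,
    Measure.restrict_apply measurableSet_Iio, Set.inter_comm, Set.Ioi_inter_Iio, Real.volume_Ioo,
    ← ENNReal.ofReal_mul (by positivity), sub_zero, ← pow_succ, show n - 2 + 1 = n - 1 by omega]

theorem norm_sph (ξ : Sph n) : ‖(ξ : Euc n)‖ = 1 := by simp

/-- The direction of a nonzero vector. -/
def dir (e : Sph n) (q : Euc n) : Sph n :=
  ⟨if q = 0 then e else ‖q‖⁻¹ • q, by
    split_ifs with h
    · exact e.2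
    · rw [mem_sphere_zero_iff_norm, norm_smul, norm_inv, norm_norm,
        inv_mul_cancel₀ (norm_ne_zero_iff.2 h)]⟩

theorem measurable_dir (e : Sph n) : Measurable (dir e) :=
  Measurable.subtype_mk (Measurable.ite (measurableSet_singleton 0) measurable_const
    (measurable_norm.inv.smul measurable_id))

theorem dir_smul (e η : Sph n) {r : ℝ} (hr : 0 < r) : dir e (r • (η : Euc n)) = η := by
  have hη : (η : Euc n) ≠ 0 := norm_ne_zero_iff.1 (by simp)
  apply Subtype.ext
  simp only [dir, smul_eq_zero, hr.ne', hη, or_self, if_false, norm_smul, norm_sph,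
    Real.norm_eq_abs, abs_of_pos hr, mul_one, smul_smul, inv_mul_cancel₀ hr.ne', one_smul]

theorem dir_pos_smul (e : Sph n) (q : Euc n) {r : ℝ} (hr : 0 < r) : dir e (r • q) = dir e q := by
  apply Subtype.ext
  simp only [dir, smul_eq_zero, hr.ne', false_or, norm_smul, Real.norm_eq_abs, abs_of_pos hr]
  split_ifs
  · rfl
  · rw [smul_smul, mul_inv_rev, mul_assoc, inv_mul_cancel₀ hr.ne', mul_one]

theorem sph_nonempty (hn : 2 ≤ n) : Nonempty (Sph n) :=
  ⟨⟨EuclideanSpace.single ⟨0, by omega⟩ 1, by simp⟩⟩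

/-- A function on the sphere is lifted to the cone and cut off by a gauge τ of degree 1. Changing
the gauge multiplies the spherical measure by τ^(-(n-1)), so Jacobians on the sphere follow from
invariance on the cone, without differentiating on the sphere. -/
theorem lintegral_lightCone (hn : 2 ≤ n) (e : Sph n) {F : Sph n → ENNReal} (hF : Measurable F)
    {τ : Euc n → ℝ} (hτ : Measurable τ) (hhom : ∀ r, 0 < r → ∀ η, τ (r • η) = r * τ η)
    (hpos : ∀ η : Sph n, 0 < τ η) :
    ∫⁻ q, ENNReal.ofReal ‖q‖⁻¹ * (F (dir e q) * rayProfile n (τ q)) =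
      ∫⁻ η, ENNReal.ofReal ((τ η)⁻¹ ^ (n - 1)) * F η ∂sphMeasure n := by
  rw [lintegral_polar hn (show Measurable fun q => F (dir e q) * rayProfile n (τ q) from
    (hF.comp (measurable_dir e)).mul (measurable_rayProfile.comp hτ))]
  refine lintegral_congr fun η => ?_
  rw [← lintegral_rayProfile hn (hpos η), ← lintegral_mul_const _
    (show Measurable fun r : ℝ => ENNReal.ofReal (r ^ (n - 2)) * rayProfile n (r * τ η) from
      Measurable.mul (by fun_prop) (measurable_rayProfile.comp (by fun_prop)))]
  refine setLIntegral_congr_fun measurableSet_Ioi fun r hr => ?_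
  simp only [dir_smul e η hr, hhom r hr]
  ring

/-- With the norm as gauge, the claim lifts to the invariance of Lebesgue measure and of the norm
under R. -/
theorem lintegral_sphMeasure_isometry (hn : 2 ≤ n) (R : Euc n ≃ₗᵢ[ℝ] Euc n)
    {F : Sph n → ENNReal} (hF : Measurable F) :
    ∫⁻ w : Sph n, F ⟨R w, by simp⟩ ∂sphMeasure n = ∫⁻ w, F w ∂sphMeasure n := by
  obtain ⟨e⟩ := sph_nonempty hn
  have hR : Measurable fun w : Sph n => (⟨R w, by simp⟩ : Sph n) :=
    Measurable.subtype_mk (R.continuous.measurable.comp measurable_subtype_coe)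
  have h1 : ∀ {F : Sph n → ENNReal} (_ : Measurable F),
      ∫⁻ q, ENNReal.ofReal ‖q‖⁻¹ * (F (dir e q) * rayProfile n ‖q‖) =
        ∫⁻ w, F w ∂sphMeasure n := fun {F} hF => by
    rw [lintegral_lightCone hn e hF measurable_norm
      (fun r hr η => by rw [norm_smul, Real.norm_eq_abs, abs_of_pos hr]) (fun η => by simp)]
    simp
  have h2 := h1 (F := fun w => F ⟨R w, by simp⟩) (hF.comp hR)
  have h3 := R.measurePreserving.lintegral_comp_emb R.toHomeomorph.measurableEmbedding
    (fun q => ENNReal.ofReal ‖q‖⁻¹ * (F (dir e q) * rayProfile n ‖q‖))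
  rw [← h1 hF, ← h2, ← h3]
  have := nontrivial_euc hn
  refine lintegral_congr_ae ?_
  filter_upwards [Measure.ae_ne volume (0 : Euc n)] with q hq
  simp only [R.norm_map]
  congr 3
  apply Subtype.ext
  have hq' : R q ≠ 0 := fun h => hq (by simpa using h)
  simp [dir, hq]

/-! ### The action of boosts on the light cone -/

/-- The exponential of the Busemann function, `-⟨x, (1, ξ)⟩`. -/
def height (x : Hyp n) (ξ : Euc n) : ℝ := x.1.1 - ⟪x.1.2, ξ⟫

theorem height_pos (x : Hyp n) (ξ : Sph n) : 0 < height x ξ := by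
  have h := real_inner_le_norm x.1.2 (ξ : Euc n)
  rw [norm_sph, mul_one] at h
  have := x.norm_lt
  simp only [height]
  linarith

theorem continuous_height_sph (x : Hyp n) : Continuous fun ξ : Sph n => height x ξ := by
  unfold height; fun_prop

theorem sq_fst_of_null {v : Mink n} (hv : mink v v = 0) (h0 : 0 ≤ v.1) : v.1 = ‖v.2‖ := by
  simp only [mink, real_inner_self_eq_norm_sq] at hv
  exact (sq_eq_sq₀ h0 (norm_nonneg _)).1 (by linarith)

theorem boostLin_null_fst (x : Hyp n) (q : Euc n) :
    x.1.1 * ‖q‖ + ⟪x.1.2, q⟫ = ‖q + (‖q‖ + ⟪x.1.2, q⟫ / (1 + x.1.1)) • x.1.2‖ := by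
  have h := sq_fst_of_null (v := boostLin x (‖q‖, q))
    (by rw [mink_boostLin]; simp [mink]; ring) (by
      rw [boostLin_fst]
      have h1 := neg_le_of_abs_le (abs_real_inner_le_norm x.1.2 q)
      have h2 := mul_le_mul_of_nonneg_right x.norm_lt.le (norm_nonneg q)
      simp only; linarith)
  rwa [boostLin_fst, boostLin_snd] at h

/-- The massless analogue of `lintegral_volHyp_boost`, with energy ‖q‖. The origin is removed
because the norm is not differentiable there; it is fixed by the boost and is a null set. -/
theorem lintegral_boost_lightCone (hn : 2 ≤ n) (x : Hyp n) (g : Euc n → ENNReal) :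
    ∫⁻ q, ENNReal.ofReal ‖q‖⁻¹ * g q = ∫⁻ q, ENNReal.ofReal ‖q‖⁻¹ *
      g (q + (‖q‖ + ⟪x.1.2, q⟫ / (1 + x.1.1)) • x.1.2) := by
  have := nontrivial_euc hn
  set T : Hyp n → Euc n → Euc n :=
    fun x q => q + (‖q‖ + ⟪x.1.2, q⟫ / (1 + x.1.1)) • x.1.2 with hT
  have hTB : ∀ x q, boostLin x (‖q‖, q) = (‖T x q‖, T x q) := fun x q => by
    ext1
    · rw [boostLin_fst, boostLin_null_fst]
    · rw [boostLin_snd]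
  have hTT : ∀ x q, T x (T x.inv q) = q := fun x q => by
    have h := boostLin_inv x (‖q‖, q)
    rw [hTB, hTB] at h
    exact congrArg Prod.snd h
  have hTT' : ∀ x q, T x.inv (T x q) = q := fun x q => by
    simpa only [Hyp.inv_inv] using hTT x.inv q
  have hT0 : ∀ x, T x 0 = 0 := fun x => by simp [hT]
  have himage : T x '' {0}ᶜ = {0}ᶜ := by
    ext q
    constructor
    · rintro ⟨p, hp, rfl⟩ h0
      exact hp (by rw [Set.mem_singleton_iff] at h0 ⊢; rw [← hTT' x p, h0, hT0])
    · intro hq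
      exact ⟨T x.inv q, fun h0 => hq (by
        rw [Set.mem_singleton_iff] at h0 ⊢; rw [← hTT x q, h0, hT0]), hTT x q⟩
  have hpos : ∀ p ∈ ({0}ᶜ : Set (Euc n)), 0 < ‖T x p‖ := fun p hp =>
    norm_pos_iff.2 (by
      have := himage.subset (Set.mem_image_of_mem _ hp)
      simpa using this)
  have key := lintegral_image_shear (φ := fun q : Euc n => ‖q‖ + ⟪x.1.2, q⟫ / (1 + x.1.1))
    (φ' := fun q => ‖q‖⁻¹ • innerSL ℝ q + (1 + x.1.1)⁻¹ • innerSL ℝ x.1.2) (a := x.1.2)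
    (E := norm) (E' := norm)
    (measurableSet_singleton (0 : Euc n)).compl (fun p hp => ?_)
    (Function.LeftInverse.injective (hTT' x)).injOn (fun p hp => norm_pos_iff.2 hp) hpos
    (fun p hp => ?_) g
  · simp only [hT] at himage
    rwa [himage, restrict_compl_singleton] at key
  · refine hasFDerivAt_add_inner_div ?_ _ _
    have h1 : HasFDerivAt (fun p : Euc n => ‖p‖ ^ 2) (2 • innerSL ℝ p) p :=
      (hasStrictFDerivAt_norm_sq p).hasFDerivAt
    have hp' : ‖p‖ ≠ 0 := norm_ne_zero_iff.2 hp
    have h2 := (h1.sqrt (pow_ne_zero 2 hp'))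
    simp only [Real.sqrt_sq (norm_nonneg _)] at h2
    refine h2.congr_fderiv ?_
    ext w
    simp
    field_simp
  · have h1 : 1 + x.1.1 ≠ 0 := by linarith [x.fst_pos]
    have h2 : ‖p‖ ≠ 0 := norm_ne_zero_iff.2 hp
    rw [← boostLin_null_fst]
    simp only [add_apply, smul_apply, innerSL_apply_apply,
      smul_eq_mul, x.inner_self, real_inner_comm x.1.2 p]
    field_simp
    ring

/-- The null vector x + `frame x w` is the boost of (1, w), so the endpoint is the direction of a
boosted null vector. -/
theorem posEnd_frameUT (e : Sph n) (x : Hyp n) (w : Sph n) : posEnd (frameUT (x, w)) =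
    dir e ((w : Euc n) + (‖(w : Euc n)‖ + ⟪x.1.2, w⟫ / (1 + x.1.1)) • x.1.2) := by
  have h1 := boostLin_null_fst x w
  have h2 : 0 < x.1.1 * ‖(w : Euc n)‖ + ⟪x.1.2, w⟫ := by
    have := neg_le_of_abs_le (abs_real_inner_le_norm x.1.2 w)
    rw [norm_sph, mul_one] at *
    linarith [x.norm_lt]
  apply Subtype.ext
  simp only [posEnd, dir, frameUT, frame]
  rw [if_neg (norm_pos_iff.1 (h1 ▸ h2)), ← h1, norm_sph, mul_one, ← add_assoc,
    add_comm x.1.2, add_assoc, add_smul, one_smul]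

/-- Both sides lift to the light cone, the left with gauge ‖q‖ = -⟨0, q⟩ and the right with gauge
-⟨x, q⟩, where q stands for (‖q‖, q) and 0 for the origin of ℍⁿ. The boost sends the origin to x, so
it exchanges the gauges and preserves the cone measure. -/
theorem lintegral_posEnd_frameUT (hn : 2 ≤ n) (x : Hyp n) {F : Sph n → ENNReal}
    (hF : Measurable F) :
    ∫⁻ w, F (posEnd (frameUT (x, w))) ∂sphMeasure n =
      ∫⁻ ξ : Sph n, ENNReal.ofReal ((height x ξ)⁻¹ ^ (n - 1)) * F ξ ∂sphMeasure n := by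
  obtain ⟨e⟩ := sph_nonempty hn
  have hT : Measurable fun q : Euc n => q + (‖q‖ + ⟪x.1.2, q⟫ / (1 + x.1.1)) • x.1.2 := by
    fun_prop
  have hpos : Measurable fun w : Sph n => posEnd (frameUT (x, w)) := by
    simp_rw [posEnd_frameUT e]
    exact (measurable_dir e).comp (hT.comp measurable_subtype_coe)
  have h1 := lintegral_lightCone hn e hF (τ := fun q => x.1.1 * ‖q‖ - ⟪x.1.2, q⟫)
    (by fun_prop) (fun r hr η => by
      simp only [norm_smul, Real.norm_eq_abs, abs_of_pos hr, real_inner_smul_right]; ring)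
    (fun η => by simpa [height] using height_pos x η)
  have h2 := lintegral_lightCone hn e (hF.comp hpos) measurable_norm
      (fun r hr η => by rw [norm_smul, Real.norm_eq_abs, abs_of_pos hr]) (fun η => by simp)
  simp only [norm_sph, mul_one, inv_one, one_pow, ENNReal.ofReal_one, one_mul,
    Function.comp] at h1 h2
  simp only [height]
  rw [← h1, ← h2, lintegral_boost_lightCone hn x
    (fun q => F (dir e q) * rayProfile n (x.1.1 * ‖q‖ - ⟪x.1.2, q⟫))]
  have := nontrivial_euc hn
  refine lintegral_congr_ae ?_
  filter_upwards [Measure.ae_ne volume (0 : Euc n)] with q hq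
  have hq0 : 0 < ‖q‖ := norm_pos_iff.2 hq
  have hd : (dir e q : Euc n) = ‖q‖⁻¹ • q := by simp [dir, hq]
  congr 3
  · have hs : q + (‖q‖ + ⟪x.1.2, q⟫ / (1 + x.1.1)) • x.1.2 = ‖q‖ • ((dir e q : Euc n) +
        (‖(dir e q : Euc n)‖ + ⟪x.1.2, dir e q⟫ / (1 + x.1.1)) • x.1.2) := by
      rw [norm_sph, hd, real_inner_smul_right, smul_add, smul_smul, smul_smul,
        mul_inv_cancel₀ hq0.ne', one_smul]
      congr 2
      field_simp
    rw [posEnd_frameUT e, hs, dir_pos_smul e _ hq0]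
  · rw [← boostLin_null_fst]
    have h1 : 1 + x.1.1 ≠ 0 := by linarith [x.fst_pos]
    simp only [inner_add_right, real_inner_smul_right, x.inner_self]
    field_simp
    ring

/-! ### Projecting `ℍⁿ` to the light cone from a point at infinity -/

/-- The point of `ℍⁿ` on the geodesic between `ξ` and the null vector above `q`, at which the
height with respect to `ξ` is that of the null vector. -/
def horoPoint (ξ : Sph n) (q : Euc n) : Hyp n :=
  chart (q + (2 * (‖q‖ - ⟪(ξ : Euc n), q⟫))⁻¹ • (ξ : Euc n))

theorem measurable_horoPoint (ξ : Sph n) : Measurable (horoPoint ξ) :=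
  continuous_chart.measurable.comp (by fun_prop)

theorem massShell_horo (ξ : Sph n) {q : Euc n} (hq : 0 < ‖q‖ - ⟪(ξ : Euc n), q⟫) :
    massShell (q + (2 * (‖q‖ - ⟪(ξ : Euc n), q⟫))⁻¹ • (ξ : Euc n)) =
      ‖q‖ + (2 * (‖q‖ - ⟪(ξ : Euc n), q⟫))⁻¹ := by
  rw [massShell, Real.sqrt_eq_iff_eq_sq (by positivity) (by positivity), norm_add_sq_real,
    norm_smul, norm_sph, real_inner_smul_right, real_inner_comm (ξ : Euc n) q, Real.norm_eq_abs,
    mul_one, sq_abs]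
  field_simp
  ring

theorem horoPoint_coe (ξ : Sph n) {q : Euc n} (hq : 0 < ‖q‖ - ⟪(ξ : Euc n), q⟫) :
    (horoPoint ξ q).1 = (‖q‖, q) + (2 * (‖q‖ - ⟪(ξ : Euc n), q⟫))⁻¹ • (1, (ξ : Euc n)) := by
  ext1
  · rw [horoPoint, chart_fst, massShell_horo ξ hq]; simp
  · simp [horoPoint, chart_snd]

theorem massShell_sub_inner_pos (ξ : Sph n) (p : Euc n) : 0 < massShell p - ⟪(ξ : Euc n), p⟫ := by
  have := height_pos (chart p) ξ
  rwa [height, chart_fst, chart_snd, real_inner_comm] at this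

theorem inv_lt_massShell (ξ : Sph n) (p : Euc n) :
    (2 * (massShell p - ⟪(ξ : Euc n), p⟫))⁻¹ < massShell p := by
  have h1 := massShell_sub_inner_pos ξ p
  have h2 := massShell_sq p
  have h3 : ⟪(ξ : Euc n), p⟫ ^ 2 ≤ ‖p‖ ^ 2 := by
    rw [← sq_abs]
    have := abs_real_inner_le_norm (ξ : Euc n) p
    rw [norm_sph, one_mul] at this
    exact pow_le_pow_left₀ (abs_nonneg _) this 2
  rw [inv_lt_iff_one_lt_mul₀ (by positivity)]
  nlinarith [pow_pos h1 2]

/-- For x on the hyperboloid of height h with respect to ξ, the vector x - c(1, ξ) has square -1 +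
2ch, so c = 1/(2h) makes it null. Its time coordinate is positive by `inv_lt_massShell`. -/
theorem norm_horo (ξ : Sph n) (p : Euc n) :
    ‖p + (-(2 * (massShell p - ⟪(ξ : Euc n), p⟫))⁻¹) • (ξ : Euc n)‖ =
      massShell p - (2 * (massShell p - ⟪(ξ : Euc n), p⟫))⁻¹ := by
  have h1 := massShell_sub_inner_pos ξ p
  have h2 := inv_lt_massShell ξ p
  rw [← sq_eq_sq₀ (norm_nonneg _) (by linarith), norm_add_sq_real,
    norm_smul, norm_sph, real_inner_smul_right, real_inner_comm (ξ : Euc n) p, Real.norm_eq_abs,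
    mul_one, sq_abs, sub_sq, massShell_sq]
  field_simp
  ring

theorem hasFDerivAt_horo (ξ : Sph n) (p : Euc n) :
    HasFDerivAt (fun p => -(2 * (massShell p - ⟪(ξ : Euc n), p⟫))⁻¹)
      ((2 * (massShell p - ⟪(ξ : Euc n), p⟫) ^ 2)⁻¹ •
        ((massShell p)⁻¹ • innerSL ℝ p - innerSL ℝ (ξ : Euc n))) p := by
  have h0 := massShell_sub_inner_pos ξ p
  have h1 : HasFDerivAt (fun p => massShell p - innerSL ℝ (ξ : Euc n) p)
      ((massShell p)⁻¹ • innerSL ℝ p - innerSL ℝ (ξ : Euc n)) p :=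
    (hasFDerivAt_massShell p).sub (innerSL ℝ (ξ : Euc n)).hasFDerivAt
  have h2 := (((hasDerivAt_inv (by simpa using h0.ne')).comp_hasFDerivAt p
    (h1.const_mul 2)).neg)
  simp only [innerSL_apply_apply] at h2
  refine h2.congr_fderiv ?_
  ext w
  simp
  field_simp

/-- Projection along (1, ξ) onto the light cone is a shear that carries dp/`massShell p` to dq/‖q‖;
polar coordinates on the cone then finish. Its image is the cone without the ray through ξ, hence
the complement of {ξ}. -/
theorem lintegral_volHyp_horo (hn : 2 ≤ n) (ξ : Sph n) {G : Hyp n → ENNReal}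
    (hG : Measurable G) :
    ∫⁻ x, G x ∂volHyp n = ∫⁻ η in ({ξ}ᶜ : Set (Sph n)), (∫⁻ r in Set.Ioi (0 : ℝ),
      ENNReal.ofReal (r ^ (n - 2)) * G (horoPoint ξ (r • (η : Euc n)))) ∂sphMeasure n := by
  set T : Euc n → Euc n := fun p => p + (-(2 * (massShell p - ⟪(ξ : Euc n), p⟫))⁻¹) • (ξ : Euc n)
    with hT
  set U : Set (Euc n) := {q | 0 < ‖q‖ - ⟪(ξ : Euc n), q⟫} with hU
  have hUm : MeasurableSet U := measurableSet_lt measurable_const (by fun_prop)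
  -- Moving along (1, ξ) does not change the height with respect to ξ, because (1, ξ) is null. So
  -- the inverse map adds back the same multiple.
  have hTh : ∀ p, ‖T p‖ - ⟪(ξ : Euc n), T p⟫ = massShell p - ⟪(ξ : Euc n), p⟫ := fun p => by
    simp only [hT, norm_horo, inner_add_right, real_inner_smul_right, real_inner_self_eq_norm_sq,
      norm_sph]
    ring
  have hST : ∀ p, horoPoint ξ (T p) = chart p := fun p => by
    rw [horoPoint, hTh]
    congr 1
    simp only [hT]
    module
  have hinj : Function.Injective T := fun p q h => by
    have := hST p
    rw [h, hST q] at this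
    exact (congrArg (fun z : Hyp n => z.1.2) this).symm
  have himage : T '' Set.univ = U := by
    ext q
    constructor
    · rintro ⟨p, -, rfl⟩
      rw [hU, Set.mem_ofPred_eq, hTh]; exact massShell_sub_inner_pos ξ p
    · intro hq
      refine ⟨q + (2 * (‖q‖ - ⟪(ξ : Euc n), q⟫))⁻¹ • (ξ : Euc n), trivial, ?_⟩
      have e : ‖q‖ + (2 * (‖q‖ - ⟪(ξ : Euc n), q⟫))⁻¹ - ⟪(ξ : Euc n),
          q + (2 * (‖q‖ - ⟪(ξ : Euc n), q⟫))⁻¹ • (ξ : Euc n)⟫ = ‖q‖ - ⟪(ξ : Euc n), q⟫ := by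
        simp only [inner_add_right, real_inner_smul_right, real_inner_self_eq_norm_sq, norm_sph]
        ring
      simp only [hT]
      rw [massShell_horo ξ hq, e]
      module
  have key := lintegral_image_shear (E := massShell) (E' := norm) MeasurableSet.univ
    (fun p _ => hasFDerivAt_horo ξ p) hinj.injOn (fun p _ => massShell_pos p)
    (fun p _ => by rw [norm_horo]; linarith [inv_lt_massShell ξ p])
    (fun p _ => by
      have h1 := massShell_sub_inner_pos ξ p
      have h2 := massShell_pos p
      rw [norm_horo]
      simp only [smul_apply, sub_apply, innerSL_apply_apply, smul_eq_mul,
        real_inner_self_eq_norm_sq, norm_sph, real_inner_comm (ξ : Euc n) p]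
      field_simp
      ring) (fun q => G (horoPoint ξ q))
  have hGm : Measurable fun q => G (horoPoint ξ q) := hG.comp (measurable_horoPoint ξ)
  change ∫⁻ q in T '' Set.univ, _ = ∫⁻ p in Set.univ, ENNReal.ofReal (massShell p)⁻¹ *
    G (horoPoint ξ (T p)) at key
  rw [himage, Measure.restrict_univ] at key
  simp_rw [hST] at key
  rw [lintegral_volHyp hG, ← key, ← lintegral_indicator hUm]
  have e1 : ∀ q, U.indicator (fun q => ENNReal.ofReal ‖q‖⁻¹ * G (horoPoint ξ q)) q =
      ENNReal.ofReal ‖q‖⁻¹ * U.indicator (fun q => G (horoPoint ξ q)) q := fun q => by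
    by_cases hq : q ∈ U <;> simp [hq]
  simp_rw [e1]
  rw [lintegral_polar hn (hGm.indicator hUm), ← lintegral_indicator
    (measurableSet_singleton ξ).compl]
  refine lintegral_congr fun η => ?_
  have hmem : ∀ r : ℝ, 0 < r → (r • (η : Euc n) ∈ U ↔ η ≠ ξ) := fun r hr => by
    have h1 : ‖r • (η : Euc n)‖ - ⟪(ξ : Euc n), r • (η : Euc n)⟫ =
        r * (1 - ⟪(ξ : Euc n), η⟫) := by
      rw [norm_smul, norm_sph, real_inner_smul_right, Real.norm_eq_abs, abs_of_pos hr]; ring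
    rw [hU, Set.mem_ofPred_eq, h1, mul_pos_iff_of_pos_left hr, sub_pos,
      inner_lt_one_iff_real_of_norm_eq_one (norm_sph ξ)
      (norm_sph η), ne_comm, Ne, Ne, Subtype.coe_inj]
  by_cases hη : η = ξ
  · rw [Set.indicator_of_notMem (by simpa using hη)]
    rw [setLIntegral_congr_fun (g := fun _ => 0) measurableSet_Ioi fun r hr => ?_]
    · simp
    · simp only
      rw [Set.indicator_of_notMem, mul_zero]
      rw [hmem r hr]; simpa using hη
  · rw [Set.indicator_of_mem (by simpa using hη)]
    refine setLIntegral_congr_fun measurableSet_Ioi fun r hr => ?_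
    rw [Set.indicator_of_mem]
    rwa [hmem r hr]

/-! ### Invariance of the Liouville measure -/

instance : SFinite (volHyp n) := by unfold volHyp; infer_instance

instance : IsFiniteMeasure (sphMeasure n) := by unfold sphMeasure; infer_instance

theorem measurable_frameUT : Measurable (frameUT (n := n)) := by
  refine Measurable.subtype_mk (Measurable.prodMk (by fun_prop) ?_)
  unfold frame
  fun_prop

theorem lintegral_liouvilleCover {f : UT n → ENNReal} (hf : Measurable f) :
    ∫⁻ v, f v ∂liouvilleCover n = ∫⁻ x, (∫⁻ w, f (frameUT (x, w)) ∂sphMeasure n) ∂volHyp n := by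
  rw [liouvilleCover, lintegral_map hf measurable_frameUT, lintegral_prod _
    (show Measurable fun p => f (frameUT p) from hf.comp measurable_frameUT).aemeasurable]

theorem measurable_smul_UT (g : isom n) : Measurable fun v : UT n => g • v := by
  have hg := LinearMap.continuous_of_finiteDimensional g.1.toLinearMap
  have : Continuous fun v : UT n => g • v :=
    Continuous.subtype_mk ((hg.comp (continuous_fst.comp continuous_subtype_val)).prodMk
      (hg.comp (continuous_snd.comp continuous_subtype_val))) _
  exact this.measurable

theorem frame_eq_boost (x : Hyp n) (w : Euc n) : frame x w = (boost x).1 (0, w) := by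
  rw [boost_apply]; simp [boostLin]

/-- The maps g ∘ `boost x` and `boost (g • x)` agree at the origin, so they differ by a rotation.
The frames are equivariant only up to this rotation, which the spherical measure does not see. -/
theorem smul_frameUT (g : isom n) (x : Hyp n) :
    ∃ R : Euc n ≃ₗᵢ[ℝ] Euc n, ∀ w : Sph n,
      g • frameUT (x, w) = frameUT (g • x, ⟨R w, by simp⟩) := by
  have hfix : ((boost (g • x))⁻¹ * (g * boost x)) • origin n = origin n := by
    rw [mul_smul, mul_smul, boost_smul_origin, inv_smul_eq_iff, boost_smul_origin]
  refine ⟨rotation _ hfix, fun w => Subtype.ext (Prod.ext rfl ?_)⟩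
  show g.1 (frame x w) = frame (g • x) _
  have h := isom_apply_of_fix hfix (0, w)
  rw [frame_eq_boost, frame_eq_boost]
  simp only at h ⊢
  rw [← h]
  have : g * boost x = boost (g • x) * ((boost (g • x))⁻¹ * (g * boost x)) := by
    rw [mul_inv_cancel_left]
  exact congrArg (fun k : isom n => k.1 (0, (w : Euc n))) this

theorem map_smul_liouvilleCover (hn : 2 ≤ n) (g : isom n) :
    (liouvilleCover n).map (g • ·) = liouvilleCover n := by
  refine Measure.ext_of_lintegral _ fun f hf => ?_
  have hm : Measurable fun p => f (frameUT p) := hf.comp measurable_frameUT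
  rw [lintegral_map hf (measurable_smul_UT g), lintegral_liouvilleCover
    (show Measurable fun v : UT n => f (g • v) from hf.comp (measurable_smul_UT g)),
    lintegral_liouvilleCover hf, ← lintegral_volHyp_smul g hm.lintegral_prod_right']
  refine lintegral_congr fun x => ?_
  obtain ⟨R, hR⟩ := smul_frameUT g x
  simp_rw [hR]
  exact lintegral_sphMeasure_isometry hn R (F := fun w => f (frameUT (g • x, w)))
    (hm.comp measurable_prodMk_left)

/-! ### The Busemann cocycle and the visual distance -/

theorem neg_mink_null (x : Mink n) (ξ : Euc n) : -mink x (1, ξ) = x.1 - ⟪x.2, ξ⟫ := by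
  simp [mink]

/-- Quantifies arcosh y = log(y + √(y² - 1)) ~ log 2y. The rate a is 1 for the distance from a point
to a ray and 2 for the distance between two rays. -/
theorem tendsto_arcosh_sub {y : ℝ → ℝ} {a L : ℝ} (ha : 0 < a) (hL : 0 < L)
    (hy : Tendsto (fun t => 2 * Real.exp (-(a * t)) * y t) atTop (𝓝 L)) :
    Tendsto (fun t => Real.arcosh (y t) - a * t) atTop (𝓝 (Real.log L)) := by
  have he : Tendsto (fun t : ℝ => Real.exp (-(a * t))) atTop (𝓝 0) :=
    Real.tendsto_exp_neg_atTop_nhds_zero.comp (tendsto_id.const_mul_atTop ha)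
  have h1 : Tendsto (fun t => 2 * Real.exp (-(a * t)) * y t +
      Real.sqrt ((2 * Real.exp (-(a * t)) * y t) ^ 2 - (2 * Real.exp (-(a * t))) ^ 2)) atTop
      (𝓝 (L + Real.sqrt (L ^ 2 - (2 * 0) ^ 2))) :=
    hy.add ((hy.pow 2).sub ((he.const_mul 2).pow 2)).sqrt
  have h2 : L + Real.sqrt (L ^ 2 - (2 * 0) ^ 2) = 2 * L := by
    rw [mul_zero, zero_pow two_ne_zero, sub_zero, Real.sqrt_sq hL.le]; ring
  rw [h2] at h1
  have h3 := (h1.div_const 2).log (by positivity)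
  rw [mul_div_cancel_left₀ L two_ne_zero] at h3
  refine h3.congr' ?_
  filter_upwards [hy.eventually (lt_mem_nhds hL)] with t ht
  have hE := Real.exp_pos (-(a * t))
  have hyt : 0 < y t := by
    by_contra h
    exact absurd ht (not_lt.2 (mul_nonpos_of_nonneg_of_nonpos (by positivity) (not_lt.1 h)))
  have e : (2 * Real.exp (-(a * t)) * y t) ^ 2 - (2 * Real.exp (-(a * t))) ^ 2 =
      (2 * Real.exp (-(a * t))) ^ 2 * (y t ^ 2 - 1) := by ring
  rw [e, Real.sqrt_mul (sq_nonneg _), Real.sqrt_sq (by positivity), ← mul_add, mul_assoc,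
    mul_div_cancel_left₀ _ two_ne_zero, Real.log_mul hE.ne' (by positivity), Real.log_exp,
    Real.arcosh]
  ring

theorem ray_coe (ξ : Sph n) (t : ℝ) :
    (ray ξ t).1 = (Real.cosh t, Real.sinh t • (ξ : Euc n)) := by
  simp [ray, geod, originDir]

theorem two_exp_cosh (t : ℝ) : 2 * Real.exp (-t) * Real.cosh t = 1 + Real.exp (-t) ^ 2 := by
  have h : Real.exp (-t) * Real.exp t = 1 := by rw [← Real.exp_add]; simp
  rw [Real.cosh_eq]
  linear_combination h

theorem two_exp_sinh (t : ℝ) : 2 * Real.exp (-t) * Real.sinh t = 1 - Real.exp (-t) ^ 2 := by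
  have h : Real.exp (-t) * Real.exp t = 1 := by rw [← Real.exp_add]; simp
  rw [Real.sinh_eq]
  linear_combination h

theorem tendsto_hdist_ray (x : Hyp n) (ξ : Sph n) :
    Tendsto (fun t => hdist x (ray ξ t) - t) atTop (𝓝 (Real.log (height x ξ))) := by
  have he := Real.tendsto_exp_neg_atTop_nhds_zero
  have h := tendsto_arcosh_sub (y := fun t => -mink x.1 (ray ξ t).1) one_pos (height_pos x ξ) (by
    have h1 : Tendsto (fun t => (1 + Real.exp (-t) ^ 2) * x.1.1 -
        (1 - Real.exp (-t) ^ 2) * ⟪x.1.2, (ξ : Euc n)⟫) atTop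
        (𝓝 ((1 + 0 ^ 2) * x.1.1 - (1 - 0 ^ 2) * ⟪x.1.2, (ξ : Euc n)⟫)) :=
      (((he.pow 2).const_add 1).mul_const _).sub (((he.pow 2).const_sub 1).mul_const _)
    convert h1 using 1
    · funext t
      rw [ray_coe, one_mul, ← two_exp_cosh, ← two_exp_sinh]
      simp only [mink, real_inner_smul_right]
      ring
    · simp [height])
  simpa [hdist] using h

theorem busemann_eq (ξ : Sph n) (x : Hyp n) :
    busemann ξ x (origin n) = Real.log (height x ξ) := by
  refine Tendsto.limUnder_eq ?_
  have h1 := (tendsto_hdist_ray x ξ).sub (tendsto_hdist_ray (origin n) ξ)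
  have h2 : height (origin n) ξ = 1 := by simp [height, origin]
  rw [h2, Real.log_one, sub_zero] at h1
  refine h1.congr fun t => ?_
  rw [hdist_comm x, hdist_comm (origin n)]
  ring

theorem one_sub_inner_pos {ξ η : Sph n} (h : η ≠ ξ) : 0 < 1 - ⟪(ξ : Euc n), η⟫ := by
  rw [sub_pos, inner_lt_one_iff_real_of_norm_eq_one (norm_sph ξ) (norm_sph η)]
  exact fun e => h (Subtype.ext e.symm)

/-- Each distance from x grows like t and the distance between the rays like 2t, so the linear terms
cancel and the three constants remain. -/
theorem visualDist_eq (x : Hyp n) {ξ η : Sph n} (h : η ≠ ξ) : visualDist x ξ η =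
    Real.exp (-(1 / 2) * (Real.log (height x ξ) + Real.log (height x η) -
      Real.log ((1 - ⟪(ξ : Euc n), η⟫) / 2))) := by
  refine Tendsto.limUnder_eq ?_
  have he := Real.tendsto_exp_neg_atTop_nhds_zero
  have h0 := one_sub_inner_pos h
  have h1 := tendsto_arcosh_sub (y := fun t => -mink (ray ξ t).1 (ray η t).1) two_pos
    (half_pos h0) (by
      have h1 : Tendsto (fun t => ((1 + Real.exp (-t) ^ 2) ^ 2 -
          (1 - Real.exp (-t) ^ 2) ^ 2 * ⟪(ξ : Euc n), (η : Euc n)⟫) / 2) atTop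
          (𝓝 (((1 + 0 ^ 2) ^ 2 - (1 - 0 ^ 2) ^ 2 * ⟪(ξ : Euc n), (η : Euc n)⟫) / 2)) :=
        (((((he.pow 2).const_add 1).pow 2).sub
          ((((he.pow 2).const_sub 1).pow 2).mul_const _))).div_const 2
      convert h1 using 1
      · funext t
        rw [ray_coe, ray_coe, ← two_exp_cosh, ← two_exp_sinh]
        simp only [mink, real_inner_smul_right, real_inner_smul_left]
        rw [show -(2 * t) = -t + -t by ring, Real.exp_add]
        ring
      · simp)
  have h2 := (((tendsto_hdist_ray x ξ).add (tendsto_hdist_ray x η)).sub h1).const_mul (-(1 / 2))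
  refine ((Real.continuous_exp.tendsto _).comp h2).congr fun t => ?_
  simp only [Function.comp, hdist]
  congr 1
  ring

theorem visualDist_rpow (hn : 2 ≤ n) (x : Hyp n) {ξ η : Sph n} (h : η ≠ ξ) :
    visualDist x ξ η ^ (-(2 * ((n : ℝ) - 1))) =
      (height x ξ * height x η * (2 * (1 - ⟪(ξ : Euc n), η⟫)⁻¹)) ^ (n - 1) := by
  have h0 := one_sub_inner_pos h
  have h1 := height_pos x ξ
  have h2 := height_pos x η
  rw [visualDist_eq x h, ← Real.exp_mul, ← Real.log_mul h1.ne' h2.ne',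
    ← Real.log_div (by positivity) (by positivity)]
  rw [show -(1 / 2) * Real.log (height x ξ * height x η / ((1 - ⟪(ξ : Euc n), η⟫) / 2)) *
    (-(2 * ((n : ℝ) - 1))) = ((n - 1 : ℕ) : ℝ) *
      Real.log (height x ξ * height x η / ((1 - ⟪(ξ : Euc n), η⟫) / 2)) by
    rw [Nat.cast_pred (by omega)]; ring, Real.exp_nat_mul, Real.exp_log (by positivity)]
  congr 1
  field_simp

/-! ### Hopf's parametrisation -/

/-- The time coordinate of the null vector `x + u`, where `v = (x, u)`. -/
def posScale (v : UT n) : ℝ := v.1.1.1 + v.1.2.1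

theorem posScale_pos (v : UT n) : 0 < posScale v := by
  have := (abs_lt.1 v.2.abs_lt).1
  simp only [posScale]; linarith

theorem add_eq_posScale_smul (v : UT n) :
    v.1.1 + v.1.2 = posScale v • ((1, (posEnd v : Euc n)) : Mink n) := by
  ext1
  · simp [posScale]
  · show _ = posScale v • (posScale v)⁻¹ • (v.1.1.2 + v.1.2.2)
    rw [smul_smul, mul_inv_cancel₀ (posScale_pos v).ne', one_smul]
    rfl

theorem sub_eq_posScale_smul (v : UT n) :
    v.1.1 - v.1.2 = posScale (flip v) • ((1, (negEnd v : Euc n)) : Mink n) := by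
  rw [negEnd, ← add_eq_posScale_smul, sub_eq_add_neg]
  rfl

theorem mink_null_null (ξ η : Euc n) :
    mink ((1, ξ) : Mink n) (1, η) = -(1 - ⟪ξ, η⟫) := by
  simp [mink]

/-- This is ⟨x + u, x - u⟩ = -2. The endpoints thus fix the product of the two scales, and only
their ratio is free; Hopf's time measures it. -/
theorem posScale_mul (v : UT n) :
    posScale v * posScale (flip v) * (1 - ⟪(posEnd v : Euc n), negEnd v⟫) = 2 := by
  obtain ⟨⟨h1, -⟩, h2, h3⟩ := v.2
  have h : mink (v.1.1 + v.1.2) (v.1.1 - v.1.2) = -2 := by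
    rw [sub_eq_add_neg, ← neg_one_smul ℝ v.1.2]
    simp only [mink_add_left, mink_add_right, mink_smul_right, h1, h2, h3, mink_comm v.1.2 v.1.1]
    ring
  rw [add_eq_posScale_smul, sub_eq_posScale_smul, mink_smul_left, mink_smul_right,
    mink_null_null] at h
  linarith

theorem posEnd_ne_negEnd (v : UT n) : negEnd v ≠ posEnd v := by
  intro h
  have := posScale_mul v
  rw [h, real_inner_self_eq_norm_sq, norm_sph] at this
  norm_num at this

theorem neg_mink_add (x₀ : Hyp n) (v : UT n) :
    -mink x₀.1 (v.1.1 + v.1.2) = posScale v * height x₀ (posEnd v) := by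
  rw [add_eq_posScale_smul, mink_smul_right, ← mul_neg, neg_mink_null]; rfl

theorem neg_mink_sub (x₀ : Hyp n) (v : UT n) :
    -mink x₀.1 (v.1.1 - v.1.2) = posScale (flip v) * height x₀ (negEnd v) := by
  rw [sub_eq_posScale_smul, mink_smul_right, ← mul_neg, neg_mink_null]; rfl

/-- Since v(s) = (e^s (x + u) + e^(-s) (x - u)) / 2, the left side is (P e^s + Q e^(-s)) / 2 with P
and Q the two products under the logarithms. Pulling out √(PQ) leaves a translated cosh. -/
theorem cosh_hdist_geod (x₀ : Hyp n) (v : UT n) (s : ℝ) :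
    Real.cosh (hdist x₀ (geod v s)) =
      Real.exp ((Real.log (posScale v * height x₀ (posEnd v)) +
        Real.log (posScale (flip v) * height x₀ (negEnd v))) / 2) *
      Real.cosh (s + (Real.log (posScale v * height x₀ (posEnd v)) -
        Real.log (posScale (flip v) * height x₀ (negEnd v))) / 2) := by
  have hP := mul_pos (posScale_pos v) (height_pos x₀ (posEnd v))
  have hQ := mul_pos (posScale_pos (flip v)) (height_pos x₀ (negEnd v))
  have h1 := Real.exp_log hP
  have h2 := Real.exp_log hQ
  rw [← neg_mink_add] at h1 ⊢
  rw [← neg_mink_sub] at h2 ⊢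
  set p := Real.log (-mink x₀.1 (v.1.1 + v.1.2))
  set q := Real.log (-mink x₀.1 (v.1.1 - v.1.2))
  rw [cosh_hdist, Real.cosh_eq (s + (p - q) / 2), mul_div_assoc', mul_add, ← Real.exp_add,
    ← Real.exp_add, show (p + q) / 2 + (s + (p - q) / 2) = s + p by ring,
    show (p + q) / 2 + -(s + (p - q) / 2) = -s + q by ring, Real.exp_add, Real.exp_add, h1, h2]
  have e : (geod v s).1 = (Real.exp s / 2) • (v.1.1 + v.1.2) +
      (Real.exp (-s) / 2) • (v.1.1 - v.1.2) := by
    simp only [geod, Real.cosh_eq, Real.sinh_eq]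
    module
  rw [e, mink_add_right, mink_smul_right, mink_smul_right]
  ring

/-- The translated cosh has exactly one minimum, so the choice made by `Classical.epsilon` is
forced. -/
theorem hopfTime_eq (x₀ : Hyp n) (v : UT n) : hopfTime x₀ v =
    (Real.log (posScale v * height x₀ (posEnd v)) -
      Real.log (posScale (flip v) * height x₀ (negEnd v))) / 2 := by
  have key : ∀ t, IsHopfTime x₀ v t ↔ t = (Real.log (posScale v * height x₀ (posEnd v)) -
      Real.log (posScale (flip v) * height x₀ (negEnd v))) / 2 := by
    intro t
    have h1 : ∀ s, hdist x₀ (geod v (-t)) ≤ hdist x₀ (geod v s) ↔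
        |-t + (Real.log (posScale v * height x₀ (posEnd v)) -
          Real.log (posScale (flip v) * height x₀ (negEnd v))) / 2| ≤
        |s + (Real.log (posScale v * height x₀ (posEnd v)) -
          Real.log (posScale (flip v) * height x₀ (negEnd v))) / 2| := fun s => by
      have e : hdist x₀ (geod v (-t)) ≤ hdist x₀ (geod v s) ↔
          Real.cosh (hdist x₀ (geod v (-t))) ≤ Real.cosh (hdist x₀ (geod v s)) := by
        rw [Real.cosh_le_cosh, abs_of_nonneg (hdist_nonneg _ _),
          abs_of_nonneg (hdist_nonneg _ _)]
      rw [e, cosh_hdist_geod, cosh_hdist_geod, mul_le_mul_iff_right₀ (Real.exp_pos _),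
        Real.cosh_le_cosh]
    simp only [IsHopfTime, h1]
    constructor
    · intro h
      have h2 := h (-((Real.log (posScale v * height x₀ (posEnd v)) -
        Real.log (posScale (flip v) * height x₀ (negEnd v))) / 2))
      rw [neg_add_cancel, abs_zero, abs_nonpos_iff] at h2
      linarith
    · rintro rfl s
      rw [neg_add_cancel, abs_zero]
      exact abs_nonneg _
  exact (key _).1 (Classical.epsilon_spec ⟨_, (key _).2 rfl⟩)

/-- The endpoints determine the product of the two scales and the time their ratio, hence both
scales; these give x + u and x - u, and so x and u. -/
theorem hopf_injective (x₀ : Hyp n) : Function.Injective (hopf x₀) := by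
  intro v w h
  obtain ⟨h1, h2, h3⟩ : negEnd v = negEnd w ∧ posEnd v = posEnd w ∧
      hopfTime x₀ v = hopfTime x₀ w := by simpa [hopf] using h
  have a1 := posScale_pos v
  have a2 := posScale_pos (flip v)
  have b1 := posScale_pos w
  have b2 := posScale_pos (flip w)
  have hm : posScale v * posScale (flip v) = posScale w * posScale (flip w) := by
    have hv := posScale_mul v
    have hw := posScale_mul w
    have h0 := one_sub_inner_pos (posEnd_ne_negEnd w)
    rw [h1, h2] at hv
    exact mul_right_cancel₀ h0.ne' (hv.trans hw.symm)
  have hl := congrArg Real.log hm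
  rw [Real.log_mul a1.ne' a2.ne', Real.log_mul b1.ne' b2.ne'] at hl
  rw [hopfTime_eq, hopfTime_eq, h1, h2] at h3
  have c1 := height_pos x₀ (posEnd w)
  have c2 := height_pos x₀ (negEnd w)
  rw [Real.log_mul a1.ne' c1.ne', Real.log_mul a2.ne' c2.ne', Real.log_mul b1.ne' c1.ne',
    Real.log_mul b2.ne' c2.ne'] at h3
  have e1 : posScale v = posScale w := Real.log_injOn_pos a1 b1 (by linarith)
  have e2 : posScale (flip v) = posScale (flip w) := Real.log_injOn_pos a2 b2 (by linarith)
  have f1 := add_eq_posScale_smul v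
  have f2 := sub_eq_posScale_smul v
  rw [e1, h2, ← add_eq_posScale_smul] at f1
  rw [e2, h1, ← sub_eq_posScale_smul] at f2
  have g1 : v.1.1 = w.1.1 := by
    have : (2 : ℝ) • v.1.1 = (2 : ℝ) • w.1.1 := by
      calc (2 : ℝ) • v.1.1 = (v.1.1 + v.1.2) + (v.1.1 - v.1.2) := by module
        _ = (w.1.1 + w.1.2) + (w.1.1 - w.1.2) := by rw [f1, f2]
        _ = _ := by module
    exact smul_right_injective _ two_ne_zero this
  rw [g1] at f1
  exact Subtype.ext (Prod.ext g1 (add_left_cancel f1))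

theorem measurable_posEnd : Measurable (posEnd (n := n)) :=
  Measurable.subtype_mk (by fun_prop)

theorem measurable_flip : Measurable (flip (n := n)) :=
  Measurable.subtype_mk (by fun_prop)

theorem measurable_hopf (x₀ : Hyp n) : Measurable (hopf x₀) := by
  have h1 : Measurable (negEnd (n := n)) := measurable_posEnd.comp measurable_flip
  refine h1.prodMk (measurable_posEnd.prodMk ?_)
  have e : hopfTime x₀ = fun v : UT n => (Real.log (-mink x₀.1 (v.1.1 + v.1.2)) -
      Real.log (-mink x₀.1 (v.1.1 - v.1.2))) / 2 := by
    funext v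
    rw [hopfTime_eq, neg_mink_add, neg_mink_sub]
  rw [e]
  unfold mink
  fun_prop

/-! ### The unit tangent vector at a given point towards a given point at infinity -/

/-- The unit tangent vector at `x` that points to `ξ`. -/
def vecTo (x : Hyp n) (ξ : Sph n) : UT n :=
  ⟨(x.1, (height x ξ)⁻¹ • ((1, (ξ : Euc n)) : Mink n) + (-1 : ℝ) • x.1), by
    have h0 := (height_pos x ξ).ne'
    have h1 : mink x.1 (1, (ξ : Euc n)) = -height x ξ := by
      rw [height, ← neg_mink_null, neg_neg]
    have h2 : mink ((1, (ξ : Euc n)) : Mink n) (1, (ξ : Euc n)) = 0 := by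
      rw [mink_null_null, real_inner_self_eq_norm_sq, norm_sph]; norm_num
    refine ⟨x.2, ?_, ?_⟩
    · simp only [mink_add_right, mink_smul_right, h1, x.2.1]
      field_simp
      ring
    · simp only [mink_add_right, mink_add_left, mink_smul_right, mink_smul_left, h1, h2, x.2.1,
        mink_comm _ x.1]
      field_simp
      ring⟩

theorem posEnd_vecTo (x : Hyp n) (ξ : Sph n) : posEnd (vecTo x ξ) = ξ := by
  have h := add_eq_posScale_smul (vecTo x ξ)
  have e : (vecTo x ξ).1.1 + (vecTo x ξ).1.2 = (height x ξ)⁻¹ • ((1, (ξ : Euc n)) : Mink n) := by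
    simp only [vecTo]; module
  rw [e] at h
  have h1 := congrArg Prod.fst h
  have h2 := congrArg Prod.snd h
  simp only [Prod.smul_fst, Prod.smul_snd, smul_eq_mul, mul_one] at h1 h2
  rw [h1] at h2
  exact (Subtype.ext (smul_right_injective _ (posScale_pos _).ne' h2)).symm

theorem vecTo_posEnd (v : UT n) : vecTo (foot v) (posEnd v) = v := by
  have h := add_eq_posScale_smul v
  have h1 : height (foot v) (posEnd v) = (posScale v)⁻¹ := by
    have h2 := neg_mink_add (foot v) v
    rw [mink_add_right] at h2
    simp only [foot, v.2.1.1, v.2.2.1] at h2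
    rw [← one_div, eq_div_iff (posScale_pos v).ne', mul_comm]
    simp only [foot]
    linarith
  refine Subtype.ext (Prod.ext rfl ?_)
  show (height (foot v) (posEnd v))⁻¹ • ((1, (posEnd v : Euc n)) : Mink n) + (-1 : ℝ) • v.1.1 = _
  rw [h1, inv_inv, ← h]
  module

theorem measurable_vecTo : Measurable fun p : Hyp n × Sph n => vecTo p.1 p.2 := by
  refine Measurable.subtype_mk ?_
  unfold height
  fun_prop

/-- The footpoint is a combination of (1, η) and (1, ξ), and the tangent vector u satisfies x - u =
2r(1, η) and x + u = (1, ξ) divided by the height of x. Both scales can be read off, and r enters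
the time only through -log r. -/
theorem hopf_vecTo_horoPoint (x₀ : Hyp n) {ξ η : Sph n} (h : η ≠ ξ) {r : ℝ} (hr : 0 < r) :
    hopf x₀ (vecTo (horoPoint ξ (r • (η : Euc n))) ξ) =
      (η, ξ, -Real.log r + Real.log (height x₀ ξ /
        (2 * (1 - ⟪(ξ : Euc n), η⟫) * height x₀ η)) / 2) := by
  have h0 := one_sub_inner_pos h
  have hq : ‖r • (η : Euc n)‖ - ⟪(ξ : Euc n), r • (η : Euc n)⟫ = r * (1 - ⟪(ξ : Euc n), η⟫) := by
    rw [norm_smul, norm_sph, real_inner_smul_right, Real.norm_eq_abs, abs_of_pos hr]; ring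
  have hqp : 0 < ‖r • (η : Euc n)‖ - ⟪(ξ : Euc n), r • (η : Euc n)⟫ := by
    rw [hq]; positivity
  have hx := horoPoint_coe ξ hqp
  rw [hq] at hx
  set x := horoPoint ξ (r • (η : Euc n))
  set v := vecTo x ξ with hv
  have hx' : x.1 = r • ((1, (η : Euc n)) : Mink n) +
      (2 * (r * (1 - ⟪(ξ : Euc n), η⟫)))⁻¹ • ((1, (ξ : Euc n)) : Mink n) := by
    rw [hx]; ext1
    · simp [norm_smul, abs_of_pos hr]
    · simp
  have hh : height x ξ = r * (1 - ⟪(ξ : Euc n), η⟫) := by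
    rw [height, ← neg_mink_null, hx', mink_add_left, mink_smul_left, mink_smul_left,
      mink_null_null, mink_null_null, real_inner_self_eq_norm_sq, norm_sph, real_inner_comm]
    ring
  have hpe : posEnd v = ξ := posEnd_vecTo x ξ
  have hadd : v.1.1 + v.1.2 = (r * (1 - ⟪(ξ : Euc n), η⟫))⁻¹ • ((1, (ξ : Euc n)) : Mink n) := by
    simp only [hv, vecTo, hh]; module
  have hsub : v.1.1 - v.1.2 = (2 * r) • ((1, (η : Euc n)) : Mink n) := by
    simp only [hv, vecTo, hh]
    rw [mul_inv] at hx'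
    rw [show x.1 - ((r * (1 - ⟪(ξ : Euc n), η⟫))⁻¹ • ((1, (ξ : Euc n)) : Mink n) +
      (-1 : ℝ) • x.1) = (2 : ℝ) • x.1 -
        (r * (1 - ⟪(ξ : Euc n), η⟫))⁻¹ • ((1, (ξ : Euc n)) : Mink n) by module, hx']
    module
  have s1 := congrArg Prod.fst ((add_eq_posScale_smul v).symm.trans hadd)
  have s2 := congrArg Prod.fst ((sub_eq_posScale_smul v).symm.trans hsub)
  have s3 := congrArg Prod.snd ((sub_eq_posScale_smul v).symm.trans hsub)
  simp only [Prod.smul_fst, Prod.smul_snd, smul_eq_mul, mul_one] at s1 s2 s3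
  rw [s2] at s3
  have hne : negEnd v = η :=
    Subtype.ext (smul_right_injective _ (by positivity : (2 * r) ≠ 0) s3)
  have c1 := height_pos x₀ ξ
  have c2 := height_pos x₀ η
  rw [hopf, hopfTime_eq, hpe, hne, s1, s2]
  congr 2
  rw [Real.log_mul (by positivity) c1.ne', Real.log_inv, Real.log_mul hr.ne' h0.ne',
    Real.log_mul (by positivity) c2.ne', Real.log_mul two_ne_zero hr.ne',
    Real.log_div c1.ne' (by positivity), Real.log_mul (by positivity) c2.ne',
    Real.log_mul two_ne_zero h0.ne']
  ring

theorem height_horoPoint {ξ η : Sph n} (h : η ≠ ξ) {r : ℝ} (hr : 0 < r) :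
    height (horoPoint ξ (r • (η : Euc n))) ξ = r * (1 - ⟪(ξ : Euc n), η⟫) := by
  have h0 := one_sub_inner_pos h
  have hq : ‖r • (η : Euc n)‖ - ⟪(ξ : Euc n), r • (η : Euc n)⟫ = r * (1 - ⟪(ξ : Euc n), η⟫) := by
    rw [norm_smul, norm_sph, real_inner_smul_right, Real.norm_eq_abs, abs_of_pos hr]; ring
  rw [height, horoPoint_coe ξ (by rw [hq]; positivity), hq]
  simp only [Prod.fst_add, Prod.snd_add, Prod.smul_fst, Prod.smul_snd, inner_add_left,
    real_inner_smul_left, real_inner_self_eq_norm_sq, norm_sph, norm_smul, Real.norm_eq_abs,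
    abs_of_pos hr, smul_eq_mul, real_inner_comm (ξ : Euc n) η]
  ring

/-! ### The Bowen-Margulis measure and the Liouville measure of the cover -/

theorem lintegral_neg_log_add (c : ℝ) (g : ℝ → ENNReal) :
    ∫⁻ r in Set.Ioi (0 : ℝ), ENNReal.ofReal r⁻¹ * g (-Real.log r + c) = ∫⁻ t, g t := by
  have hd : ∀ r ∈ Set.Ioi (0 : ℝ),
      HasDerivWithinAt (fun r => -Real.log r + c) (-r⁻¹) (Set.Ioi 0) r := fun r hr =>
    ((Real.hasDerivAt_log (ne_of_gt hr)).neg.add_const c).hasDerivWithinAt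
  have hinj : Set.InjOn (fun r => -Real.log r + c) (Set.Ioi 0) := fun r hr s hs h =>
    Real.log_injOn_pos hr hs (by simpa using h)
  have himage : (fun r => -Real.log r + c) '' Set.Ioi 0 = Set.univ := by
    refine Set.eq_univ_of_forall fun t => ⟨Real.exp (c - t), Real.exp_pos _, ?_⟩
    simp
  have h := lintegral_image_eq_lintegral_abs_deriv_mul measurableSet_Ioi hd hinj g
  rw [himage, Measure.restrict_univ] at h
  rw [h]
  refine setLIntegral_congr_fun measurableSet_Ioi fun r hr => ?_
  simp only [abs_neg]
  rw [abs_of_pos (inv_pos.2 hr)]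

theorem measurable_inner_sph :
    Measurable fun p : Sph n × Sph n => ⟪(p.1 : Euc n), (p.2 : Euc n)⟫ := by fun_prop

theorem measurable_lineSection {g : Sph n × Sph n × ℝ → ENNReal} (hg : Measurable g)
    (η ξ : Sph n) : Measurable fun t : ℝ => g (η, ξ, t) := by
  have h : Measurable fun t : ℝ => (η, ξ, t) :=
    measurable_const.prodMk (measurable_const.prodMk measurable_id)
  exact hg.comp h

theorem measurable_height : Measurable fun p : Hyp n × Sph n => height p.1 p.2 := by
  unfold height; fun_prop

/-- A vector is determined by its footpoint and positive endpoint. After the fibre sphere is traded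
for the boundary, the order of integration is exchanged so that ξ can be held fixed. -/
theorem lintegral_liouvilleCover_vecTo (hn : 2 ≤ n) {f : UT n → ENNReal} (hf : Measurable f) :
    ∫⁻ v, f v ∂liouvilleCover n = ∫⁻ ξ : Sph n, (∫⁻ x, ENNReal.ofReal ((height x ξ)⁻¹ ^ (n - 1)) *
      f (vecTo x ξ) ∂volHyp n) ∂sphMeasure n := by
  have hvec : Measurable fun p : Hyp n × Sph n => f (vecTo p.1 p.2) := hf.comp measurable_vecTo
  have hjoint : Measurable fun p : Hyp n × Sph n =>
      ENNReal.ofReal ((height p.1 p.2)⁻¹ ^ (n - 1)) * f (vecTo p.1 p.2) :=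
    (measurable_height.inv.pow_const _).ennreal_ofReal.mul hvec
  have h1 : ∀ x : Hyp n, ∫⁻ w, f (frameUT (x, w)) ∂sphMeasure n =
      ∫⁻ ξ : Sph n, ENNReal.ofReal ((height x ξ)⁻¹ ^ (n - 1)) * f (vecTo x ξ)
        ∂sphMeasure n := fun x => by
    have hF := hvec.comp (measurable_prodMk_left (x := x) (β := Sph n))
    rw [← lintegral_posEnd_frameUT hn x (F := fun ξ => f (vecTo x ξ)) hF]
    refine lintegral_congr fun w => ?_
    have : vecTo x (posEnd (frameUT (x, w))) = frameUT (x, w) := vecTo_posEnd (frameUT (x, w))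
    rw [this]
  rw [lintegral_liouvilleCover hf, lintegral_congr h1]
  exact lintegral_lintegral_swap hjoint.aemeasurable

/-- The cone contributes r^(n-2) dr and the height contributes (r(1 - ⟪ξ, η⟫))^(-(n-1)), which
leaves dr/r, that is dt. The base point enters only through an additive constant in t, which the
integral over t ignores. -/
theorem lintegral_liouvilleCover_hopf (hn : 2 ≤ n) (x₀ : Hyp n)
    {g : Sph n × Sph n × ℝ → ENNReal} (hg : Measurable g) :
    ∫⁻ v, g (hopf x₀ v) ∂liouvilleCover n = ∫⁻ ξ, (∫⁻ η in ({ξ}ᶜ : Set (Sph n)),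
      ENNReal.ofReal ((1 - ⟪(ξ : Euc n), η⟫)⁻¹ ^ (n - 1)) * (∫⁻ t, g (η, ξ, t))
        ∂sphMeasure n) ∂sphMeasure n := by
  have hgH : Measurable fun v => g (hopf x₀ v) := hg.comp (measurable_hopf x₀)
  have hvec : Measurable fun p : Hyp n × Sph n => g (hopf x₀ (vecTo p.1 p.2)) :=
    hgH.comp measurable_vecTo
  have hjoint : Measurable fun p : Hyp n × Sph n =>
      ENNReal.ofReal ((height p.1 p.2)⁻¹ ^ (n - 1)) * g (hopf x₀ (vecTo p.1 p.2)) :=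
    (measurable_height.inv.pow_const _).ennreal_ofReal.mul hvec
  rw [lintegral_liouvilleCover_vecTo hn hgH]
  refine lintegral_congr fun ξ => ?_
  have hG := hjoint.comp (measurable_prodMk_right (y := ξ) (α := Hyp n))
  rw [lintegral_volHyp_horo hn ξ (G := fun x => ENNReal.ofReal ((height x ξ)⁻¹ ^ (n - 1)) *
    g (hopf x₀ (vecTo x ξ))) hG]
  refine setLIntegral_congr_fun (measurableSet_singleton ξ).compl fun η hη => ?_
  have h0 := one_sub_inner_pos (ξ := ξ) (η := η) hη
  have hm : Measurable fun t : ℝ => g (η, ξ, t) :=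
    measurable_lineSection hg η ξ
  set c := Real.log (height x₀ ξ / (2 * (1 - ⟪(ξ : Euc n), η⟫) * height x₀ η)) / 2 with hc
  have hmc : Measurable fun r : ℝ => ENNReal.ofReal r⁻¹ * g (η, ξ, -Real.log r + c) :=
    measurable_inv.ennreal_ofReal.mul (hm.comp (Real.measurable_log.neg.add_const c))
  rw [← lintegral_neg_log_add c (fun t => g (η, ξ, t)), ← lintegral_const_mul _ hmc]
  refine setLIntegral_congr_fun measurableSet_Ioi fun r (hr : 0 < r) => ?_
  rw [hopf_vecTo_horoPoint x₀ hη hr, height_horoPoint hη hr, ← hc, ← mul_assoc, ← mul_assoc,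
    ← ENNReal.ofReal_mul (by positivity), ← ENNReal.ofReal_mul (by positivity)]
  congr 2
  rw [show n - 1 = (n - 2) + 1 by omega, mul_inv, mul_pow, pow_succ r⁻¹, inv_pow r]
  have : r ^ (n - 2) ≠ 0 := by positivity
  field_simp

theorem sphericalDensity_eq (hn : 2 ≤ n) (x : Hyp n) : sphericalDensity n x =
    (sphMeasure n).withDensity fun ξ => ENNReal.ofReal ((height x ξ)⁻¹ ^ (n - 1)) := by
  unfold sphericalDensity
  congr 1
  funext ξ
  have h := height_pos x ξ
  rw [busemann_eq, show -((n : ℝ) - 1) * Real.log (height x ξ) =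
    ((n - 1 : ℕ) : ℝ) * -Real.log (height x ξ) by rw [Nat.cast_pred (by omega)]; ring,
    Real.exp_nat_mul, Real.exp_neg, Real.exp_log h]

instance (x : Hyp n) : SFinite (sphericalDensity n x) := by
  unfold sphericalDensity; infer_instance

theorem measurable_poissonKernel (x : Hyp n) :
    Measurable fun ξ : Sph n => ENNReal.ofReal ((height x ξ)⁻¹ ^ (n - 1)) :=
  ((continuous_height_sph x).measurable.inv.pow_const _).ennreal_ofReal

theorem lintegral_sphericalDensity (hn : 2 ≤ n) (x : Hyp n) {F : Sph n → ENNReal}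
    (hF : Measurable F) : ∫⁻ ξ, F ξ ∂sphericalDensity n x =
      ∫⁻ ξ : Sph n, ENNReal.ofReal ((height x ξ)⁻¹ ^ (n - 1)) * F ξ ∂sphMeasure n := by
  rw [sphericalDensity_eq hn, lintegral_withDensity_eq_lintegral_mul _
    (measurable_poissonKernel x) hF]
  rfl

theorem measurableSet_isHyp : MeasurableSet {x : Mink n | IsHyp x} := by
  have h : Measurable fun x : Mink n => mink x x := by unfold mink; fun_prop
  exact (measurableSet_eq_fun h measurable_const).inter
    (measurableSet_lt measurable_const measurable_fst)

/-- By the Lusin-Souslin theorem this makes the injective measurable map `hopf x₀` a measurable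
embedding, so that the `comap` defining the Bowen-Margulis measure can be evaluated on images. -/
instance : StandardBorelSpace (UT n) := by
  have h : ∀ f g : Mink n × Mink n → Mink n, Measurable f → Measurable g →
      Measurable fun v => mink (f v) (g v) := fun f g hf hg => by unfold mink; fun_prop
  have h1 : MeasurableSet {v : Mink n × Mink n | IsUnitTangent v} :=
    (measurableSet_isHyp.preimage measurable_fst).inter
      ((measurableSet_eq_fun (h _ _ measurable_fst measurable_snd) measurable_const).inter
        (measurableSet_eq_fun (h _ _ measurable_snd measurable_snd) measurable_const))
  exact h1.standardBorel

/-- The power `-2(n-1)` of the visual distance. -/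
def visualKernel (x : Hyp n) (η ξ : Sph n) : ENNReal :=
  ENNReal.ofReal ((height x η * height x ξ * (2 * (1 - ⟪(η : Euc n), ξ⟫)⁻¹)) ^ (n - 1))

theorem measurable_visualKernel (x : Hyp n) :
    Measurable fun p : Sph n × Sph n => visualKernel x p.1 p.2 := by
  have h1 := (continuous_height_sph x).measurable
  exact ((((h1.comp measurable_fst).mul (h1.comp measurable_snd)).mul
    ((measurable_inner_sph.const_sub 1).inv.const_mul 2)).pow_const _).ennreal_ofReal

/-- All dependence on x cancels. The constant of the theorem is born here, from the 2 in d_x(ξ,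
η)^(-2) = 2 h(ξ) h(η) / (1 - ⟪ξ, η⟫). -/
theorem poissonKernel_mul_visualKernel (x : Hyp n) {ξ η : Sph n} (h : η ≠ ξ) :
    ENNReal.ofReal ((height x η)⁻¹ ^ (n - 1)) * (ENNReal.ofReal ((height x ξ)⁻¹ ^ (n - 1)) *
      visualKernel x η ξ) =
    2 ^ (n - 1) * ENNReal.ofReal ((1 - ⟪(ξ : Euc n), η⟫)⁻¹ ^ (n - 1)) := by
  have h0 := one_sub_inner_pos h
  have c1 := height_pos x ξ
  have c2 := height_pos x η
  rw [visualKernel, real_inner_comm (ξ : Euc n) (η : Euc n), ← ENNReal.ofReal_mul (by positivity),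
    ← ENNReal.ofReal_mul (by positivity), show (2 : ENNReal) ^ (n - 1) =
      ENNReal.ofReal (2 ^ (n - 1)) by rw [ENNReal.ofReal_pow (by norm_num)]; simp,
    ← ENNReal.ofReal_mul (by positivity), ← mul_pow, ← mul_pow, ← mul_pow]
  congr 2
  field_simp

theorem lintegral_bowenMargulis_prod (hn : 2 ≤ n) (x₀ : Hyp n)
    {g : Sph n × Sph n × ℝ → ENNReal} (hg : Measurable g) :
    ∫⁻ p, visualKernel x₀ p.1 p.2.1 * g p
      ∂((sphericalDensity n x₀).prod ((sphericalDensity n x₀).prod (volume : Measure ℝ))) =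
    ∫⁻ ξ : Sph n, (∫⁻ η : Sph n, ENNReal.ofReal ((height x₀ η)⁻¹ ^ (n - 1)) *
      (ENNReal.ofReal ((height x₀ ξ)⁻¹ ^ (n - 1)) * (visualKernel x₀ η ξ * ∫⁻ t, g (η, ξ, t)))
        ∂sphMeasure n) ∂sphMeasure n := by
  have hk := measurable_visualKernel x₀
  have hp := measurable_poissonKernel x₀
  have hF : Measurable fun p : Sph n × Sph n × ℝ => visualKernel x₀ p.1 p.2.1 * g p :=
    (hk.comp (measurable_fst.prodMk measurable_snd.fst)).mul hg
  have hgt : Measurable fun p : Sph n × Sph n => ∫⁻ t, g (p.1, p.2, t) :=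
    Measurable.lintegral_prod_right' (f := fun q : (Sph n × Sph n) × ℝ => g (q.1.1, q.1.2, q.2))
      (hg.comp (by fun_prop))
  have hFt : Measurable fun p : Sph n × Sph n =>
      visualKernel x₀ p.1 p.2 * ∫⁻ t, g (p.1, p.2, t) := hk.mul hgt
  have hin : Measurable fun p : Sph n × Sph n => ENNReal.ofReal ((height x₀ p.2)⁻¹ ^ (n - 1)) *
      (visualKernel x₀ p.1 p.2 * ∫⁻ t, g (p.1, p.2, t)) := (hp.comp measurable_snd).mul hFt
  have hall : Measurable fun p : Sph n × Sph n => ENNReal.ofReal ((height x₀ p.1)⁻¹ ^ (n - 1)) *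
      (ENNReal.ofReal ((height x₀ p.2)⁻¹ ^ (n - 1)) *
        (visualKernel x₀ p.1 p.2 * ∫⁻ t, g (p.1, p.2, t))) := (hp.comp measurable_fst).mul hin
  have e2 : ∀ η : Sph n, ∫⁻ q, visualKernel x₀ η q.1 * g (η, q)
        ∂((sphericalDensity n x₀).prod (volume : Measure ℝ)) =
      ∫⁻ ξ : Sph n, ENNReal.ofReal ((height x₀ ξ)⁻¹ ^ (n - 1)) *
        (visualKernel x₀ η ξ * ∫⁻ t, g (η, ξ, t)) ∂sphMeasure n := fun η => by
    have hFη : Measurable fun q : Sph n × ℝ => visualKernel x₀ η q.1 * g (η, q) := by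
      have h := hF.comp (measurable_prodMk_left (x := η) (β := Sph n × ℝ))
      exact h
    have hFtη : Measurable fun ξ => visualKernel x₀ η ξ * ∫⁻ t, g (η, ξ, t) := by
      have h := hFt.comp (measurable_prodMk_left (x := η) (β := Sph n))
      exact h
    rw [lintegral_prod _ hFη.aemeasurable, ← lintegral_sphericalDensity hn x₀ hFtη]
    refine lintegral_congr fun ξ => ?_
    have hm : Measurable fun t : ℝ => g (η, ξ, t) :=
      measurable_lineSection hg η ξ
    exact lintegral_const_mul (visualKernel x₀ η ξ) hm
  rw [lintegral_prod _ hF.aemeasurable, lintegral_congr e2,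
    lintegral_sphericalDensity hn x₀ hin.lintegral_prod_right',
    ← lintegral_lintegral_swap hall.aemeasurable]
  refine lintegral_congr fun η => ?_
  have h := hin.comp (measurable_prodMk_left (x := η) (β := Sph n))
  exact (lintegral_const_mul _ h).symm

theorem bowenMargulisCover_eq (hn : 2 ≤ n) (Γ : Subgroup (isom n)) (x₀ : Hyp n)
    (hδ : criticalExponent Γ x₀ = (n : ℝ) - 1) :
    bowenMargulisCover Γ (sphericalDensity n) x₀ = (2 : ENNReal) ^ (n - 1) • liouvilleCover n := by
  have hemb : MeasurableEmbedding (hopf x₀) :=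
    (measurable_hopf x₀).measurableEmbedding (hopf_injective x₀)
  ext A hA
  rw [bowenMargulisCover, hemb.comap_apply, hδ]
  have hB := hemb.measurableSet_image' hA
  set B := hopf x₀ '' A with hBdef
  -- Hopf coordinates avoid the diagonal, where the formula for the visual distance is not
  -- available; there the indicator `g` vanishes.
  have hne : ∀ p ∈ B, p.1 ≠ p.2.1 := by
    rintro p ⟨v, -, rfl⟩
    exact posEnd_ne_negEnd v
  set g : Sph n × Sph n × ℝ → ENNReal := B.indicator 1 with hgdef
  have hg : Measurable g := measurable_one.indicator hB
  have hL : liouvilleCover n A = ∫⁻ v, g (hopf x₀ v) ∂liouvilleCover n := by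
    rw [← lintegral_indicator_one hA]
    refine lintegral_congr fun v => ?_
    by_cases hv : v ∈ A
    · rw [Set.indicator_of_mem hv, hgdef, Set.indicator_of_mem (Set.mem_image_of_mem _ hv)]; rfl
    · rw [Set.indicator_of_notMem hv, hgdef, Set.indicator_of_notMem]
      rwa [hBdef, (hopf_injective x₀).mem_set_image]
  have e1 : ∀ p : Sph n × Sph n × ℝ, B.indicator (fun p => ENNReal.ofReal
      (visualDist x₀ p.1 p.2.1 ^ (-(2 * ((n : ℝ) - 1))))) p =
        visualKernel x₀ p.1 p.2.1 * g p := fun p => by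
    by_cases hp : p ∈ B
    · rw [Set.indicator_of_mem hp, hgdef, Set.indicator_of_mem hp,
        visualDist_rpow hn x₀ (hne p hp).symm]
      simp [visualKernel]
    · rw [Set.indicator_of_notMem hp, hgdef, Set.indicator_of_notMem hp, mul_zero]
  rw [withDensity_apply _ hB, ← lintegral_indicator hB, lintegral_congr e1,
    lintegral_bowenMargulis_prod hn x₀ hg, Measure.smul_apply, hL,
    lintegral_liouvilleCover_hopf hn x₀ hg, smul_eq_mul, ← lintegral_const_mul' _ _ (by simp)]
  refine lintegral_congr fun ξ => ?_
  rw [← lintegral_const_mul' _ _ (by simp), ← lintegral_indicator (measurableSet_singleton ξ).compl]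
  refine lintegral_congr fun η => ?_
  by_cases hη : η = ξ
  · rw [Set.indicator_of_notMem (by simpa using hη)]
    have : ∀ t, g (η, ξ, t) = 0 := fun t => Set.indicator_of_notMem (fun h => hne _ h hη) _
    simp [this]
  · rw [Set.indicator_of_mem (by simpa using hη), ← mul_assoc _ _ (∫⁻ t, g (η, ξ, t)),
      ← mul_assoc, ← mul_assoc, mul_assoc (ENNReal.ofReal _), poissonKernel_mul_visualKernel x₀ hη,
      mul_assoc]

/-! ### Strict fundamental domains -/

/-- Cover X by countably many open sets U_i to which no nontrivial element returns a point, and keep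
in U_i the points whose orbits miss all earlier U_j. Each orbit has a first index at which it meets
the cover, and meets that U_i in a single point. -/
theorem exists_strict_fundamentalDomain {G X : Type*} [Group G] [MulAction G X]
    [TopologicalSpace X] [MeasurableSpace X] [BorelSpace X] [SecondCountableTopology X]
    [T2Space X] [LocallyCompactSpace X] [ContinuousConstSMul G X] [ProperlyDiscontinuousSMul G X]
    (hfree : ∀ (g : G) (x : X), g • x = x → g = 1) :
    ∃ F : Set X, MeasurableSet F ∧ ∀ x, ∃! g : G, g • x ∈ F := by
  rcases isEmpty_or_nonempty X with hX | hX
  · exact ⟨∅, MeasurableSet.empty, fun x => (hX.false x).elim⟩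
  have h1 : ∀ x : X, ∃ U : Set X, IsOpen U ∧ x ∈ U ∧ ∀ (g : G) (y : X), y ∈ U → g • y ∈ U →
      g = 1 := fun x => by
    obtain ⟨U, hU, h⟩ := ProperlyDiscontinuousSMul.exists_nhds_image_smul_eq_self G x
    exact ⟨interior U, isOpen_interior, mem_interior_iff_mem_nhds.2 hU, fun g y hy hgy =>
      hfree g x (h g ⟨g • y, ⟨y, interior_subset hy, rfl⟩, interior_subset hgy⟩)⟩
  choose U hUo hUx hU using h1
  obtain ⟨s, hsc, hs⟩ := TopologicalSpace.countable_cover_nhds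
    fun x => (hUo x).mem_nhds (hUx x)
  have hne : s.Nonempty := by
    by_contra hne
    rw [Set.not_nonempty_iff_eq_empty] at hne
    simp [hne] at hs
    exact (Set.empty_ne_univ hs)
  obtain ⟨f, rfl⟩ := hsc.exists_eq_range hne
  rw [Set.biUnion_range] at hs
  set V : ℕ → Set X := fun i => ⋃ g : G, (fun x => g • x) ⁻¹' U (f i) with hV
  have hVo : ∀ i, IsOpen (V i) := fun i =>
    isOpen_iUnion fun g => (hUo _).preimage (continuous_const_smul g)
  have hVmem : ∀ i x, x ∈ V i ↔ ∃ g : G, g • x ∈ U (f i) := fun i x => by simp [hV]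
  have hVinv : ∀ i (g : G) x, g • x ∈ V i ↔ x ∈ V i := fun i g x => by
    rw [hVmem, hVmem]
    exact ⟨fun ⟨k, hk⟩ => ⟨k * g, by rwa [mul_smul]⟩,
      fun ⟨k, hk⟩ => ⟨k * g⁻¹, by rwa [mul_smul, inv_smul_smul]⟩⟩
  refine ⟨⋃ i, (U (f i) \ ⋃ j, ⋃ (_ : j < i), V j), MeasurableSet.iUnion fun i =>
    (hUo _).measurableSet.diff (isOpen_iUnion fun j => isOpen_iUnion fun _ => hVo j).measurableSet,
    fun x => ?_⟩
  have hmem : ∀ y, y ∈ ⋃ i, (U (f i) \ ⋃ j, ⋃ (_ : j < i), V j) ↔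
      ∃ i, y ∈ U (f i) ∧ ∀ j < i, y ∉ V j := fun y => by simp
  have hex : ∃ i, x ∈ V i := by
    have : x ∈ ⋃ i, U (f i) := hs ▸ Set.mem_univ x
    obtain ⟨i, hi⟩ := Set.mem_iUnion.1 this
    exact ⟨i, (hVmem i x).2 ⟨1, by rwa [one_smul]⟩⟩
  classical
  obtain ⟨g, hg⟩ := (hVmem _ x).1 (Nat.find_spec hex)
  refine ⟨g, (hmem _).2 ⟨Nat.find hex, hg, fun j hj => ?_⟩, fun k hk => ?_⟩
  · rw [hVinv]; exact Nat.find_min hex hj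
  · obtain ⟨i, hi, hij⟩ := (hmem _).1 hk
    have hi' : i = Nat.find hex := by
      refine ((Nat.find_eq_iff hex).2 ⟨(hVmem i x).2 ⟨k, hi⟩, fun j hj => ?_⟩).symm
      rw [← hVinv j k]; exact hij j hj
    subst hi'
    have := hU _ (k * g⁻¹) (g • x) hg (by rwa [mul_smul, inv_smul_smul])
    rwa [mul_inv_eq_one] at this

/-- The induced measure on the quotient is the image of the restriction to a strict fundamental
domain. -/
theorem quoMeasure_eq (Γ : Subgroup (isom n)) [Countable Γ] {X : Type} [MulAction (isom n) X]
    [MeasurableSpace X] (hmeas : ∀ g : isom n, Measurable fun x : X => g • x) {m : Measure X}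
    (hinv : ∀ g : isom n, m.map (g • ·) = m) {F : Set X} (hF : MeasurableSet F)
    (hdom : ∀ x, ∃! g : Γ, g • x ∈ F) :
    quoMeasure Γ m = (m.restrict F).map Quotient.mk'' := by
  have : MeasurableConstSMul Γ X := ⟨fun g => hmeas g⟩
  have : SMulInvariantMeasure Γ X m :=
    ⟨fun g s hs => by
      conv_rhs => rw [← hinv g, Measure.map_apply (hmeas g) hs]
      rfl⟩
  have hfd : IsFundamentalDomain Γ F m := IsFundamentalDomain.mk' hF.nullMeasurableSet hdom
  have hfree : ∀ (g : Γ) (x : X), g • x = x → g = 1 := fun g x hgx => by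
    obtain ⟨h, hh, huniq⟩ := hdom x
    have := huniq (h * g) (by show (h * g) • x ∈ F; rwa [mul_smul, hgx])
    exact mul_eq_left.1 this
  have hπ : Measurable (Quotient.mk'' : X → Quo Γ X) := measurable_quotient_mk''
  have horb : ∀ x y : X, (Quotient.mk'' x : Quo Γ X) = Quotient.mk'' y ↔ ∃ g : Γ, g • y = x :=
    fun x y => Quotient.eq''
  refine le_antisymm (iSup₂_le fun A hA => iSup_le fun hinj => ?_) ?_
  -- The translates of the part of A above B, cut by F, lie in the part of F above B. They are
  -- pairwise disjoint because A meets each orbit at most once and the action is free.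
  · refine Measure.le_iff.2 fun B hB => ?_
    rw [Measure.map_apply hπ hB, Measure.map_apply hπ hB, Measure.restrict_apply (hπ hB),
      Measure.restrict_apply (hπ hB), hfd.measure_eq_tsum, ← measure_iUnion]
    · refine measure_mono (Set.iUnion_subset fun g => ?_)
      rintro x ⟨⟨y, ⟨hy, -⟩, rfl⟩, hxF⟩
      refine ⟨?_, hxF⟩
      have : (Quotient.mk'' (g • y) : Quo Γ X) = Quotient.mk'' y := (horb _ _).2 ⟨g, rfl⟩
      simp only [Set.mem_preimage] at hy ⊢
      rwa [this]
    · intro g h hgh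
      refine Set.disjoint_left.2 ?_
      rintro x ⟨⟨y, ⟨-, hy⟩, rfl⟩, -⟩ ⟨⟨z, ⟨-, hz⟩, hzy⟩, -⟩
      refine hgh ?_
      simp only at hzy
      have hzy' : z = y := hinj hz hy ((horb _ _).2 ⟨h⁻¹ * g, by
        rw [mul_smul, ← hzy, inv_smul_smul]⟩)
      subst hzy'
      have := hfree (g⁻¹ * h) z (by rw [mul_smul, hzy, inv_smul_smul])
      exact (inv_mul_eq_one.1 this)
    · exact fun g => (((hπ hB).inter hA).const_smul g).inter hF
  -- F is itself one of the sets in the supremum.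
  · refine le_iSup₂_of_le F hF (le_iSup_of_le (fun x hx y hy hxy => ?_) le_rfl)
    obtain ⟨g, rfl⟩ := (horb _ _).1 hxy
    have := (hdom y).unique (y₁ := g) (y₂ := 1) hx (by rwa [one_smul])
    rw [this, one_smul]

/-! ### The topology of `ℍⁿ` -/

theorem isClosed_isHyp : IsClosed {x : Mink n | IsHyp x} := by
  have e : {x : Mink n | IsHyp x} = {x | mink x x = -1 ∧ 0 ≤ x.1} := by
    ext x
    refine ⟨fun h => ⟨h.1, h.2.le⟩, fun h => ⟨h.1, lt_of_le_of_ne h.2 fun h0 => ?_⟩⟩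
    have h1 := h.1
    simp only [mink, real_inner_self_eq_norm_sq] at h1
    rw [← h0] at h1
    nlinarith [sq_nonneg ‖x.2‖]
  rw [e]
  exact (isClosed_eq (by unfold mink; fun_prop) continuous_const).inter
    (isClosed_le continuous_const continuous_fst)

instance : LocallyCompactSpace (Hyp n) :=
  isClosed_isHyp.isClosedEmbedding_subtypeVal.locallyCompactSpace

instance (Γ : Subgroup (isom n)) : ContinuousConstSMul Γ (Hyp n) :=
  ⟨fun g => Continuous.subtype_mk ((LinearMap.continuous_of_finiteDimensional
    g.1.1.toLinearMap).comp continuous_subtype_val) _⟩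

/-- Stabilisers are finite by proper discontinuity, so their elements are torsion. -/
theorem smul_free (Γ : Subgroup (isom n)) [ProperlyDiscontinuousSMul Γ (Hyp n)]
    (htorsion : ∀ γ ∈ Γ, IsOfFinOrder γ → γ = 1) (γ : Γ) (x : Hyp n) (h : γ • x = x) : γ = 1 := by
  have hfin := ProperlyDiscontinuousSMul.finite_stabilizer (Γ := Γ) x
  have : Finite (MulAction.stabilizer Γ x) := hfin
  have h1 : IsOfFinOrder (⟨γ, h⟩ : MulAction.stabilizer Γ x) := isOfFinOrder_of_finite _
  have h2 : IsOfFinOrder γ := (Subgroup.subtype _).isOfFinOrder h1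
  exact Subtype.ext (htorsion γ γ.2 (Γ.subtype.isOfFinOrder h2))

theorem isCompact_chart_closedBall (r : ℝ) :
    IsCompact (chart '' Metric.closedBall (0 : Euc n) r) :=
  (isCompact_closedBall _ _).image continuous_chart

theorem mem_chart_closedBall (x : Hyp n) {r : ℝ} :
    x ∈ chart '' Metric.closedBall (0 : Euc n) r ↔ ‖x.1.2‖ ≤ r := by
  constructor
  · rintro ⟨p, hp, rfl⟩
    simpa [chart_snd] using hp
  · intro h
    exact ⟨x.1.2, by simpa using h, chart_coord x⟩

theorem finite_hdist_le (Γ : Subgroup (isom n)) [ProperlyDiscontinuousSMul Γ (Hyp n)]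
    (x : Hyp n) (r : ℝ) : {γ : Γ | hdist x (γ • x) ≤ r}.Finite := by
  set R := Real.cosh (hdist (origin n) x + r)
  have hc : ∀ y : Hyp n, ‖y.1.2‖ ≤ Real.cosh (hdist (origin n) y) := fun y => by
    rw [cosh_hdist]
    simpa [mink, origin] using y.norm_lt.le
  -- The radius makes one compact set contain x and every γ • x within distance r of it.
  have hK := isCompact_chart_closedBall (n := n) (max ‖x.1.2‖ R)
  refine (ProperlyDiscontinuousSMul.finite_disjoint_inter_image hK hK).subset fun γ hγ => ?_
  refine ⟨γ • x, ⟨x, (mem_chart_closedBall x).2 (le_max_left _ _), rfl⟩,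
    (mem_chart_closedBall _).2 (le_max_of_le_right ((hc _).trans ?_))⟩
  have h1 := hdist_triangle (origin n) x (γ • x)
  have hγ' : hdist x (γ • x) ≤ r := hγ
  rw [Real.cosh_le_cosh, abs_of_nonneg (hdist_nonneg _ _)]
  exact (h1.trans (by linarith)).trans (le_abs_self _)

theorem countable_of_properlyDiscontinuous (Γ : Subgroup (isom n))
    [ProperlyDiscontinuousSMul Γ (Hyp n)] : Countable Γ := by
  rw [← Set.countable_univ_iff]
  refine (Set.countable_iUnion fun k : ℕ =>
    (finite_hdist_le Γ (origin n) k).countable).mono fun γ _ => ?_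
  obtain ⟨k, hk⟩ := exists_nat_ge (hdist (origin n) (γ • origin n))
  exact Set.mem_iUnion.2 ⟨k, hk⟩

/-! ### Volumes of balls -/

theorem measurable_hdist : Measurable fun p : Hyp n × Hyp n => hdist p.1 p.2 := by
  unfold hdist Real.arcosh mink
  fun_prop

/-- The closed ball of `ℍⁿ`. -/
def hball (x : Hyp n) (r : ℝ) : Set (Hyp n) := {y | hdist x y ≤ r}

theorem measurableSet_hball (x : Hyp n) (r : ℝ) : MeasurableSet (hball x r) := by
  have h := measurable_hdist.comp (measurable_prodMk_left (x := x) (β := Hyp n))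
  exact measurableSet_le h measurable_const

theorem volHyp_hball (x : Hyp n) (r : ℝ) :
    volHyp n (hball x r) = volHyp n (hball (origin n) r) := by
  have h := congrArg (fun m : Measure (Hyp n) => m (hball x r)) (map_smul_volHyp (boost x))
  rw [Measure.map_apply (measurable_smul_hyp _) (measurableSet_hball x r)] at h
  rw [← h]
  congr 1
  ext y
  show hdist x (boost x • y) ≤ r ↔ hdist (origin n) y ≤ r
  rw [← hdist_smul (boost x) (origin n) y, boost_smul_origin]

theorem chart_mem_hball (p : Euc n) {r : ℝ} (hr : 0 ≤ r) :
    chart p ∈ hball (origin n) r ↔ ‖p‖ ≤ Real.sinh r := by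
  have h1 : -mink (origin n).1 (chart p).1 = massShell p := by
    simp [mink, origin, chart_fst]
  show hdist _ _ ≤ r ↔ _
  rw [hdist_le_iff _ _ hr, h1, ← sq_le_sq₀ (massShell_pos p).le (Real.cosh_pos r).le,
    massShell_sq, Real.cosh_sq, ← sq_le_sq₀ (norm_nonneg p) (Real.sinh_nonneg_iff.2 hr)]
  constructor <;> intro h <;> linarith

theorem volHyp_hball_eq {r : ℝ} (hr : 0 ≤ r) : volHyp n (hball (origin n) r) =
    ∫⁻ p in Metric.closedBall (0 : Euc n) (Real.sinh r), ENNReal.ofReal (massShell p)⁻¹ := by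
  rw [← lintegral_indicator_one (measurableSet_hball _ _), lintegral_volHyp
    (measurable_one.indicator (measurableSet_hball _ _)),
    ← lintegral_indicator Metric.isClosed_closedBall.measurableSet]
  refine lintegral_congr fun p => ?_
  by_cases hp : ‖p‖ ≤ Real.sinh r
  · rw [Set.indicator_of_mem ((chart_mem_hball p hr).2 hp),
      Set.indicator_of_mem (by simpa using hp)]
    simp
  · rw [Set.indicator_of_notMem (fun h => hp ((chart_mem_hball p hr).1 h)),
      Set.indicator_of_notMem (by simpa using hp), mul_zero]

/-- The density 1/`massShell p` is at most 1/‖p‖, the chart radius is R = sinh r ≤ e^r, and the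
radial integral of s^(n-2) over (0, R] is at most R^(n-1). -/
theorem volHyp_hball_le (hn : 2 ≤ n) (x : Hyp n) {r : ℝ} (hr : 0 ≤ r) :
    volHyp n (hball x r) ≤
      ENNReal.ofReal (Real.exp (((n : ℝ) - 1) * r)) * sphMeasure n Set.univ := by
  have := nontrivial_euc hn
  have hs := Real.sinh_nonneg_iff.2 hr
  set R := Real.sinh r with hR
  have hB : MeasurableSet (Metric.closedBall (0 : Euc n) R) :=
    Metric.isClosed_closedBall.measurableSet
  rw [volHyp_hball, volHyp_hball_eq hr]
  calc ∫⁻ p in Metric.closedBall (0 : Euc n) R, ENNReal.ofReal (massShell p)⁻¹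
      ≤ ∫⁻ p in Metric.closedBall (0 : Euc n) R, ENNReal.ofReal ‖p‖⁻¹ := by
        refine lintegral_mono_ae ?_
        filter_upwards [ae_restrict_of_ae (Measure.ae_ne volume (0 : Euc n))] with p hp
        refine ENNReal.ofReal_le_ofReal (inv_anti₀ (norm_pos_iff.2 hp) ?_)
        refine le_of_sq_le_sq ?_ (massShell_pos p).le
        rw [massShell_sq]; linarith
    _ = ∫⁻ p, ENNReal.ofReal ‖p‖⁻¹ * (Metric.closedBall (0 : Euc n) R).indicator 1 p := by
        rw [← lintegral_indicator hB]
        refine lintegral_congr fun p => ?_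
        by_cases hp : p ∈ Metric.closedBall (0 : Euc n) R
        · rw [Set.indicator_of_mem hp, Set.indicator_of_mem hp]; simp
        · rw [Set.indicator_of_notMem hp, Set.indicator_of_notMem hp, mul_zero]
    _ ≤ ∫⁻ _ : Sph n, ENNReal.ofReal (R ^ (n - 1)) ∂sphMeasure n := by
        rw [lintegral_polar hn (measurable_one.indicator hB)]
        refine lintegral_mono fun η => ?_
        calc ∫⁻ s in Set.Ioi (0 : ℝ), ENNReal.ofReal (s ^ (n - 2)) *
              (Metric.closedBall (0 : Euc n) R).indicator 1 (s • (η : Euc n))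
            ≤ ∫⁻ s in Set.Ioi (0 : ℝ),
                (Set.Iic R).indicator (fun _ => ENNReal.ofReal (R ^ (n - 2))) s := by
              refine setLIntegral_mono' measurableSet_Ioi fun s (hs0 : 0 < s) => ?_
              by_cases hsR : s ≤ R
              · rw [Set.indicator_of_mem (s := Set.Iic R) hsR]
                refine le_trans (mul_le_of_le_one_right' (Set.indicator_le_self' (by simp) _)) ?_
                exact ENNReal.ofReal_le_ofReal (pow_le_pow_left₀ hs0.le hsR _)
              · rw [Set.indicator_of_notMem (s := Metric.closedBall (0 : Euc n) R), mul_zero]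
                · exact zero_le
                · simpa [norm_smul, abs_of_pos hs0] using hsR
          _ = ENNReal.ofReal (R ^ (n - 1)) := by
              rw [lintegral_indicator_const measurableSet_Iic,
                Measure.restrict_apply measurableSet_Iic, Set.inter_comm, Set.Ioi_inter_Iic,
                Real.volume_Ioc, sub_zero, ← ENNReal.ofReal_mul (by positivity), ← pow_succ,
                show n - 2 + 1 = n - 1 by omega]
    _ ≤ _ := by
        rw [lintegral_const]
        gcongr
        rw [show ((n : ℝ) - 1) * r = ((n - 1 : ℕ) : ℝ) * r by rw [Nat.cast_pred (by omega)],
          Real.exp_nat_mul]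
        refine pow_le_pow_left₀ hs ?_ _
        rw [hR, ← Real.cosh_add_sinh]
        linarith [Real.cosh_pos r]

/-- In the chart the density is at least 1/cosh r ≥ e^(-r) on a Euclidean ball of radius sinh r ≥
e^r/4; the last bound is where r ≥ 1 is used. -/
theorem le_volHyp_hball (hn : 2 ≤ n) (x : Hyp n) {r : ℝ} (hr : 1 ≤ r) :
    ENNReal.ofReal ((1 / 4) ^ n * Real.exp (((n : ℝ) - 1) * r)) *
      volume (Metric.ball (0 : Euc n) 1) ≤ volHyp n (hball x r) := by
  have := nontrivial_euc hn
  have hr0 : 0 ≤ r := by linarith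
  have hs := Real.sinh_nonneg_iff.2 hr0
  have hsinh : 1 / 4 * Real.exp r ≤ Real.sinh r := by
    have h1 : Real.exp r * Real.exp (-r) = 1 := by rw [← Real.exp_add]; simp
    have h2 : 2 ≤ Real.exp r := by linarith [Real.add_one_le_exp r]
    rw [Real.sinh_eq]
    nlinarith [Real.exp_pos (-r)]
  have hcosh : Real.cosh r ≤ Real.exp r := by
    rw [← Real.cosh_add_sinh]; linarith
  rw [volHyp_hball, volHyp_hball_eq hr0]
  calc _ ≤ ENNReal.ofReal (Real.cosh r)⁻¹ *
        volume (Metric.closedBall (0 : Euc n) (Real.sinh r)) := by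
        rw [Measure.addHaar_closedBall _ _ hs, ← mul_assoc, ← ENNReal.ofReal_mul (by positivity),
          finrank_euclideanSpace_fin]
        have h1 : (1 / 4) ^ n * Real.exp (((n : ℝ) - 1) * r) =
            (Real.exp r)⁻¹ * (1 / 4 * Real.exp r) ^ n := by
          rw [mul_pow, ← Real.exp_nat_mul, ← Real.exp_neg, mul_left_comm, ← Real.exp_add]
          congr 2; ring
        rw [h1]
        gcongr
    _ = ∫⁻ p in Metric.closedBall (0 : Euc n) (Real.sinh r), ENNReal.ofReal (Real.cosh r)⁻¹ := by
        rw [setLIntegral_const]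
    _ ≤ _ := by
        refine setLIntegral_mono' Metric.isClosed_closedBall.measurableSet fun p hp => ?_
        refine ENNReal.ofReal_le_ofReal (inv_anti₀ (massShell_pos p) ?_)
        have hp' : ‖p‖ ≤ Real.sinh r := by simpa using hp
        refine le_of_sq_le_sq ?_ (Real.cosh_pos r).le
        rw [massShell_sq, Real.cosh_sq]
        nlinarith [norm_nonneg p]

theorem volHyp_hball_lt_top (hn : 2 ≤ n) (x : Hyp n) {r : ℝ} (hr : 0 ≤ r) :
    volHyp n (hball x r) < ⊤ :=
  (volHyp_hball_le hn x hr).trans_lt (ENNReal.mul_lt_top ENNReal.ofReal_lt_top (measure_lt_top _ _))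

/-! ### Counting orbit points -/

/-- The number of elements `γ` of `Γ` with `d(x, γ y) ≤ t`. -/
def pairCount (Γ : Subgroup (isom n)) (t : ℝ) (x y : Hyp n) : ENNReal :=
  ∑' γ : Γ, (hball x t).indicator 1 (γ • y)

theorem pairCount_comm (Γ : Subgroup (isom n)) (t : ℝ) (x y : Hyp n) :
    pairCount Γ t x y = pairCount Γ t y x := by
  unfold pairCount
  rw [← (Equiv.inv Γ).tsum_eq]
  refine tsum_congr fun γ => ?_
  have : γ⁻¹ • y ∈ hball x t ↔ γ • x ∈ hball y t := by
    show hdist x ((γ⁻¹ : Γ) • y) ≤ t ↔ hdist y (γ • x) ≤ t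
    have h := hdist_smul γ.1 x ((γ⁻¹ : Γ) • y)
    have h2 : γ.1 • (γ⁻¹ : Γ) • y = y := smul_inv_smul γ y
    rw [h2] at h
    rw [← h, hdist_comm]
    rfl
  by_cases h : γ • x ∈ hball y t
  · rw [Set.indicator_of_mem h, Equiv.inv_apply, Set.indicator_of_mem (this.2 h)]; rfl
  · rw [Set.indicator_of_notMem h, Equiv.inv_apply,
      Set.indicator_of_notMem (fun h' => h (this.1 h'))]

theorem pairCount_le (Γ : Subgroup (isom n)) {t r s : ℝ} {x x' y y' : Hyp n}
    (hx : hdist x x' ≤ r) (hy : hdist y y' ≤ s) :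
    pairCount Γ t x y ≤ pairCount Γ (t + r + s) x' y' := by
  refine ENNReal.tsum_le_tsum fun γ => ?_
  by_cases h : γ • y ∈ hball x t
  · have h1 : γ • y' ∈ hball x' (t + r + s) := by
      have h2 : hdist x (γ • y) ≤ t := h
      have h3 := hdist_triangle x' x (γ • y')
      have h4 := hdist_triangle x (γ • y) (γ • y')
      have h5 : hdist (γ • y) (γ • y') = hdist y y' := hdist_smul γ.1 y y'
      rw [hdist_comm x' x] at h3
      show hdist _ _ ≤ _
      linarith
    rw [Set.indicator_of_mem h1]
    exact Set.indicator_le_self' (by simp) _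
  · rw [Set.indicator_of_notMem h]; exact zero_le

theorem pairCount_self (Γ : Subgroup (isom n)) [ProperlyDiscontinuousSMul Γ (Hyp n)]
    (x : Hyp n) (t : ℝ) :
    pairCount Γ t x x = (Nat.card {γ : Γ // hdist x (γ • x) ≤ t} : ENNReal) := by
  have hfin := finite_hdist_le Γ x t
  have h1 : pairCount Γ t x x = ∑' _ : {γ : Γ | hdist x (γ • x) ≤ t}, (1 : ENNReal) := by
    rw [tsum_subtype {γ : Γ | hdist x (γ • x) ≤ t} fun _ => (1 : ENNReal)]
    rfl
  rw [h1, ENNReal.tsum_set_one, ← hfin.cast_ncard_eq, ← Nat.card_coe_set_eq]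
  rfl

/-! ### The critical exponent of a lattice -/

theorem measurable_pairCount (Γ : Subgroup (isom n)) [Countable Γ] (t : ℝ) :
    Measurable fun p : Hyp n × Hyp n => pairCount Γ t p.1 p.2 := by
  unfold pairCount
  refine Measurable.tsum fun γ => ?_
  have hS : MeasurableSet {p : Hyp n × Hyp n | hdist p.1 (γ • p.2) ≤ t} := by
    have h := measurable_hdist.comp
      (measurable_fst.prodMk ((measurable_smul_hyp γ.1).comp measurable_snd) :
        Measurable fun p : Hyp n × Hyp n => (p.1, γ.1 • p.2))
    exact measurableSet_le h measurable_const
  exact measurable_one.indicator hS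

instance (Γ : Subgroup (isom n)) : MeasurableConstSMul Γ (Hyp n) :=
  ⟨fun γ => measurable_smul_hyp γ.1⟩

instance (Γ : Subgroup (isom n)) : SMulInvariantMeasure Γ (Hyp n) (volHyp n) :=
  ⟨fun γ s hs => by
    conv_rhs => rw [← map_smul_volHyp γ.1, Measure.map_apply (measurable_smul_hyp γ.1) hs]
    rfl⟩

/-- Unfolding: the translates of F tile ℍⁿ, so summing over the group while integrating over F
integrates the indicator of the ball over the whole space. -/
theorem lintegral_pairCount (Γ : Subgroup (isom n)) [Countable Γ] {F : Set (Hyp n)}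
    (hF : IsFundamentalDomain Γ F (volHyp n)) (t : ℝ) (x : Hyp n) :
    ∫⁻ y in F, pairCount Γ t x y ∂volHyp n = volHyp n (hball (origin n) t) := by
  have hm : Measurable ((hball x t).indicator (1 : Hyp n → ENNReal)) :=
    measurable_one.indicator (measurableSet_hball x t)
  rw [← volHyp_hball x t, ← lintegral_indicator_one (measurableSet_hball x t),
    hF.lintegral_eq_tsum'']
  exact lintegral_tsum fun γ => (hm.comp (measurable_smul_hyp γ.1)).aemeasurable

/-- In a fundamental domain, a set that fills more than half of the volume returns to itself. -/
theorem volHyp_hball_mul_le (Γ : Subgroup (isom n)) [Countable Γ] {F A : Set (Hyp n)}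
    (hF : IsFundamentalDomain Γ F (volHyp n)) (hA : MeasurableSet A) (hAF : A ⊆ F) {x₀ : Hyp n}
    {r : ℝ} (hAr : A ⊆ hball x₀ r) (t : ℝ) :
    volHyp n (hball (origin n) t) * volHyp n A ≤
      pairCount Γ (t + r + r) x₀ x₀ * volHyp n A * volHyp n A +
        volHyp n (hball (origin n) t) * volHyp n (F \ A) := by
  have hsplit : ∀ x, volHyp n (hball (origin n) t) = (∫⁻ y in A, pairCount Γ t x y ∂volHyp n) +
      ∫⁻ y in F \ A, pairCount Γ t x y ∂volHyp n := fun x => by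
    rw [← lintegral_pairCount Γ hF t x, ← lintegral_inter_add_sdiff _ F hA,
      Set.inter_eq_self_of_subset_right hAF]
  have hK := measurable_pairCount Γ t
  have hKA : Measurable fun x => ∫⁻ y in A, pairCount Γ t x y ∂volHyp n :=
    hK.lintegral_prod_right'
  calc volHyp n (hball (origin n) t) * volHyp n A
      = ∫⁻ _ in A, volHyp n (hball (origin n) t) ∂volHyp n := (setLIntegral_const _ _).symm
    _ = ∫⁻ x in A, ((∫⁻ y in A, pairCount Γ t x y ∂volHyp n) +
          ∫⁻ y in F \ A, pairCount Γ t x y ∂volHyp n) ∂volHyp n :=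
        lintegral_congr fun x => hsplit x
    _ = (∫⁻ x in A, ∫⁻ y in A, pairCount Γ t x y ∂volHyp n ∂volHyp n) +
          ∫⁻ x in A, ∫⁻ y in F \ A, pairCount Γ t x y ∂volHyp n ∂volHyp n :=
        lintegral_add_left hKA _
    _ ≤ _ := by
      refine add_le_add ?_ ?_
      -- Points of A are within r of x₀, so moving both variables to x₀ enlarges the radius by 2r.
      · rw [← setLIntegral_const, ← setLIntegral_const]
        refine setLIntegral_mono' hA fun x hx => setLIntegral_mono' hA fun y hy => ?_
        refine pairCount_le Γ ?_ ?_
        · rw [hdist_comm]; exact hAr hx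
        · rw [hdist_comm]; exact hAr hy
      -- By symmetry of the count, A may be enlarged to F in the other variable; each y outside A
      -- then contributes at most one full ball volume.
      · rw [lintegral_lintegral_swap hK.aemeasurable, ← setLIntegral_const]
        refine lintegral_mono fun y => ?_
        rw [← lintegral_pairCount Γ hF t y]
        simp_rw [pairCount_comm Γ t _ y]
        exact lintegral_mono_set hAF

/-- For every y in A, the count at radius t + r dominates the count for x₀ at radius t; integrating
over A, then enlarging it to F, gives the bound. -/
theorem pairCount_mul_le (Γ : Subgroup (isom n)) [Countable Γ] {F A : Set (Hyp n)}
    (hF : IsFundamentalDomain Γ F (volHyp n)) (hA : MeasurableSet A) (hAF : A ⊆ F) {x₀ : Hyp n}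
    {r : ℝ} (hAr : A ⊆ hball x₀ r) (t : ℝ) :
    pairCount Γ t x₀ x₀ * volHyp n A ≤ volHyp n (hball (origin n) (t + r)) := by
  rw [← lintegral_pairCount Γ hF (t + r) x₀, ← setLIntegral_const]
  refine (setLIntegral_mono' hA fun y hy => ?_).trans (lintegral_mono_set hAF)
  have h := pairCount_le Γ (t := t) (show hdist x₀ x₀ ≤ 0 by
    rw [hdist, x₀.2.1]; simp) (show hdist x₀ y ≤ r from hAr hy)
  rwa [add_zero] at h

/-- A ball holding more than half of the volume of F makes `volHyp_hball_mul_le` a genuine lower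
bound: the error term can then be absorbed on the left. -/
theorem exists_large_ball {F : Set (Hyp n)} (hF0 : volHyp n F ≠ 0) (hFfin : volHyp n F ≠ ⊤)
    (x₀ : Hyp n) : ∃ k : ℕ, volHyp n (F \ hball x₀ k) < volHyp n (F ∩ hball x₀ k) := by
  have hmono : Monotone fun k : ℕ => F ∩ hball x₀ k := fun i j hij =>
    Set.inter_subset_inter_right _ fun y (hy : hdist _ _ ≤ _) =>
      show hdist x₀ y ≤ j from hy.trans (by exact_mod_cast hij)
  have hU : ⋃ k : ℕ, F ∩ hball x₀ k = F := by
    rw [← Set.inter_iUnion, Set.inter_eq_left]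
    intro y _
    obtain ⟨k, hk⟩ := exists_nat_ge (hdist x₀ y)
    exact Set.mem_iUnion.2 ⟨k, hk⟩
  have h := tendsto_measure_iUnion_atTop (μ := volHyp n) hmono
  rw [hU] at h
  obtain ⟨k, hk⟩ := (h.eventually (lt_mem_nhds (ENNReal.half_lt_self hF0 hFfin))).exists
  replace hk : volHyp n F / 2 < volHyp n (F ∩ hball x₀ k) := hk
  refine ⟨k, ?_⟩
  by_contra hle
  rw [not_lt] at hle
  have h1 := measure_inter_add_sdiff (μ := volHyp n) F (measurableSet_hball x₀ k)
  have h2 : volHyp n F / 2 < volHyp n (F \ hball x₀ k) := hk.trans_le hle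
  have h3 := ENNReal.add_lt_add hk h2
  rw [h1, ENNReal.add_halves] at h3
  exact lt_irrefl _ h3

theorem tendsto_log_div {N : ℕ → ℝ} {c C d : ℝ} (hc : 0 < c)
    (hlow : ∀ᶠ k : ℕ in atTop, c * Real.exp (d * k) ≤ N k)
    (hup : ∀ᶠ k : ℕ in atTop, N k ≤ C * Real.exp (d * k)) :
    Tendsto (fun k : ℕ => (1 / (k : ℝ)) * Real.log (N k)) atTop (𝓝 d) := by
  have hlim : ∀ b : ℝ, Tendsto (fun k : ℕ => b / (k : ℝ) + d) atTop (𝓝 d) := fun b => by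
    simpa using (tendsto_const_div_atTop_nhds_zero_nat b).add_const d
  refine tendsto_of_tendsto_of_tendsto_of_le_of_le' (hlim (Real.log c)) (hlim (Real.log C)) ?_ ?_
  · filter_upwards [hlow, eventually_gt_atTop 0] with k hk hk0
    have hk0' : (0 : ℝ) < k := by exact_mod_cast hk0
    have h := Real.log_le_log (by positivity) hk
    rw [Real.log_mul hc.ne' (Real.exp_pos _).ne', Real.log_exp] at h
    rw [one_div, inv_mul_eq_div, div_add' _ _ _ hk0'.ne']
    gcongr
  · filter_upwards [hlow, hup, eventually_gt_atTop 0] with k hk hk' hk0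
    have hk0' : (0 : ℝ) < k := by exact_mod_cast hk0
    have hN : 0 < N k := lt_of_lt_of_le (by positivity) hk
    have hC : 0 < C := pos_of_mul_pos_left (hN.trans_le hk') (Real.exp_pos _).le
    have h := Real.log_le_log hN hk'
    rw [Real.log_mul hC.ne' (Real.exp_pos _).ne', Real.log_exp] at h
    rw [one_div, inv_mul_eq_div, div_add' _ _ _ hk0'.ne']
    gcongr

/-- The orbit count at x₀ lies between two positive multiples of exp((n-1)k) for large k: the
bounded part A of F, with more than half of its volume, compares it with ball volumes from both
sides. -/
theorem criticalExponent_eq (hn : 2 ≤ n) (Γ : Subgroup (isom n)) [Countable Γ]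
    [ProperlyDiscontinuousSMul Γ (Hyp n)] {F : Set (Hyp n)} (hFm : MeasurableSet F)
    (hF : IsFundamentalDomain Γ F (volHyp n)) (hFfin : volHyp n F ≠ ⊤) (x₀ : Hyp n) :
    criticalExponent Γ x₀ = (n : ℝ) - 1 := by
  have := nontrivial_euc hn
  set ω := volume (Metric.ball (0 : Euc n) 1) with hω
  have hω0 : 0 < ω.toReal := ENNReal.toReal_pos
    (Metric.measure_ball_pos volume _ one_pos).ne' measure_ball_lt_top.ne
  have hlowV : ∀ t : ℝ, 1 ≤ t → (1 / 4) ^ n * Real.exp (((n : ℝ) - 1) * t) * ω.toReal ≤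
      (volHyp n (hball (origin n) t)).toReal := fun t ht => by
    have h := ENNReal.toReal_mono (volHyp_hball_lt_top hn _ (by linarith)).ne
      (le_volHyp_hball hn (origin n) ht)
    rwa [ENNReal.toReal_mul, ENNReal.toReal_ofReal (by positivity)] at h
  have hupV : ∀ t : ℝ, 0 ≤ t → (volHyp n (hball (origin n) t)).toReal ≤
      Real.exp (((n : ℝ) - 1) * t) * (sphMeasure n Set.univ).toReal := fun t ht => by
    have h := ENNReal.toReal_mono
      (ENNReal.mul_lt_top ENNReal.ofReal_lt_top (measure_lt_top _ _)).ne
      (volHyp_hball_le hn (origin n) ht)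
    rwa [ENNReal.toReal_mul, ENNReal.toReal_ofReal (by positivity)] at h
  have hF0 : volHyp n F ≠ 0 := hF.measure_ne_zero fun h => by
    have h1 := hlowV 1 le_rfl
    rw [h] at h1
    simp only [Measure.coe_zero, Pi.zero_apply, ENNReal.toReal_zero] at h1
    exact absurd h1 (not_le.2 (by positivity))
  obtain ⟨k₀, hk₀⟩ := exists_large_ball hF0 hFfin x₀
  set r : ℝ := (k₀ : ℝ) with hr
  have hr0 : 0 ≤ r := Nat.cast_nonneg _
  set A := F ∩ hball x₀ r
  have hA : MeasurableSet A := hFm.inter (measurableSet_hball _ _)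
  have hAF : A ⊆ F := Set.inter_subset_left
  have hAr : A ⊆ hball x₀ r := Set.inter_subset_right
  have hAfin : volHyp n A ≠ ⊤ := ne_top_of_le_ne_top hFfin (measure_mono hAF)
  have hdiff : F \ A = F \ hball x₀ r := Set.sdiff_self_inter
  set a := (volHyp n A).toReal
  set b := (volHyp n (F \ A)).toReal
  have hbfin : volHyp n (F \ A) ≠ ⊤ := ne_top_of_le_ne_top hFfin (measure_mono Set.sdiff_subset)
  have hba : b < a := (ENNReal.toReal_lt_toReal hbfin hAfin).2 (by rwa [hdiff])
  have ha : 0 < a := lt_of_le_of_lt ENNReal.toReal_nonneg hba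
  set N : ℝ → ℝ := fun t => (Nat.card {γ : Γ // hdist x₀ (γ • x₀) ≤ t} : ℝ)
  have hN : ∀ t, (pairCount Γ t x₀ x₀).toReal = N t := fun t => by
    rw [pairCount_self, ENNReal.toReal_natCast]
  have hNtop : ∀ t, pairCount Γ t x₀ x₀ ≠ ⊤ := fun t => by
    rw [pairCount_self]; exact ENNReal.natCast_ne_top _
  have hup : ∀ t : ℝ, 0 ≤ t → N t * a ≤
      Real.exp (((n : ℝ) - 1) * (t + r)) * (sphMeasure n Set.univ).toReal := fun t ht => by
    have h := ENNReal.toReal_mono (volHyp_hball_lt_top hn _ (by positivity)).ne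
      (pairCount_mul_le Γ hF hA hAF hAr t)
    rw [ENNReal.toReal_mul, hN] at h
    exact h.trans (hupV _ (by positivity))
  have hlow : ∀ t : ℝ, 1 ≤ t → (1 / 4) ^ n * Real.exp (((n : ℝ) - 1) * t) * ω.toReal * (a - b) ≤
      N (t + r + r) * a * a := fun t ht => by
    have hVfin := (volHyp_hball_lt_top hn (origin n) (show 0 ≤ t by linarith)).ne
    have h1 := ENNReal.mul_ne_top (ENNReal.mul_ne_top (hNtop (t + r + r)) hAfin) hAfin
    have h2 := ENNReal.mul_ne_top hVfin hbfin
    have h := ENNReal.toReal_mono (ENNReal.add_ne_top.2 ⟨h1, h2⟩)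
      (volHyp_hball_mul_le Γ hF hA hAF hAr t)
    rw [ENNReal.toReal_add h1 h2, ENNReal.toReal_mul, ENNReal.toReal_mul, ENNReal.toReal_mul,
      ENNReal.toReal_mul, hN] at h
    have h3 := mul_le_mul_of_nonneg_right (hlowV t ht) (sub_pos.2 hba).le
    linarith
  refine Tendsto.limUnder_eq (tendsto_log_div (N := fun k : ℕ => N k) (d := (n : ℝ) - 1)
    (c := (1 / 4) ^ n * Real.exp (((n : ℝ) - 1) * -(r + r)) * ω.toReal * (a - b) / (a * a))
    (C := Real.exp (((n : ℝ) - 1) * r) * (sphMeasure n Set.univ).toReal / a) ?_ ?_ ?_)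
  · have := sub_pos.2 hba
    positivity
  -- The lower bound is applied at t = k - 2r, and the threshold ensures t ≥ 1; the shift is the
  -- factor exp(-(n-1)·2r) in the constant c.
  · filter_upwards [eventually_ge_atTop (1 + k₀ + k₀)] with k hk
    have hk' : (1 : ℝ) + r + r ≤ k := by rw [hr]; exact_mod_cast hk
    have h := hlow (k - r - r) (by linarith)
    rw [show (k : ℝ) - r - r + r + r = k by ring, show ((n : ℝ) - 1) * (k - r - r) =
      ((n : ℝ) - 1) * -(r + r) + ((n : ℝ) - 1) * k by ring, Real.exp_add] at h
    rw [div_mul_eq_mul_div, div_le_iff₀ (by positivity)]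
    linarith
  · filter_upwards with k
    have h := hup k (Nat.cast_nonneg _)
    rw [mul_add, Real.exp_add] at h
    rw [div_mul_eq_mul_div, le_div_iff₀ ha]
    linarith

/-! ### Descent to the quotient and total mass -/

theorem liouvilleCover_preimage_foot {F : Set (Hyp n)} (hF : MeasurableSet F) :
    liouvilleCover n (foot ⁻¹' F) = volHyp n F * sphMeasure n Set.univ := by
  have hfoot : Measurable (foot (n := n)) := Measurable.subtype_mk (by fun_prop)
  have e : frameUT ⁻¹' (foot ⁻¹' F) = F ×ˢ (Set.univ : Set (Sph n)) := by
    ext p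
    simp only [Set.mem_preimage, Set.mem_prod, Set.mem_univ, and_true]
    rfl
  rw [liouvilleCover, Measure.map_apply measurable_frameUT (hfoot hF), e, Measure.prod_prod]

end HypBM
end

theorem mainTheorem2 (n : ℕ) (hn : 2 ≤ n) (Γ : Subgroup (HypBM.isom n))
    (hdiscrete : ProperlyDiscontinuousSMul Γ (HypBM.Hyp n))
    (htorsion : ∀ γ ∈ Γ, IsOfFinOrder γ → γ = 1)
    (hfinite : HypBM.volM Γ Set.univ < ⊤) (x₀ : HypBM.Hyp n) :
    HypBM.bowenMargulisM Γ x₀ = (2 : ENNReal) ^ (n - 1) • HypBM.liouvilleM Γ ∧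
    HypBM.bowenMargulisM Γ x₀ Set.univ =
      (2 : ENNReal) ^ (n - 1) * HypBM.sphMeasure n Set.univ * HypBM.volM Γ Set.univ := by
  have := HypBM.countable_of_properlyDiscontinuous Γ
  obtain ⟨F, hF, hdom⟩ := HypBM.exists_strict_fundamentalDomain (HypBM.smul_free Γ htorsion)
  have hvol : HypBM.volM Γ = ((HypBM.volHyp n).restrict F).map Quotient.mk'' :=
    HypBM.quoMeasure_eq Γ HypBM.measurable_smul_hyp HypBM.map_smul_volHyp hF hdom
  have hfoot : Measurable (HypBM.foot (n := n)) := Measurable.subtype_mk (by fun_prop)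
  -- The footpoint map is equivariant, so the preimage of F is a strict fundamental domain in the
  -- unit tangent bundle.
  have hdom' : ∀ v : HypBM.UT n, ∃! γ : Γ, γ • v ∈ HypBM.foot ⁻¹' F := fun v =>
    hdom (HypBM.foot v)
  have hinv := HypBM.map_smul_liouvilleCover hn
  have hL : HypBM.liouvilleM Γ =
      ((HypBM.liouvilleCover n).restrict (HypBM.foot ⁻¹' F)).map Quotient.mk'' :=
    HypBM.quoMeasure_eq Γ HypBM.measurable_smul_UT hinv (hfoot hF) hdom'
  have hvoluniv : HypBM.volM Γ Set.univ = HypBM.volHyp n F := by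
    rw [hvol, Measure.map_apply measurable_quotient_mk'' MeasurableSet.univ]
    simp
  have hLuniv : HypBM.liouvilleM Γ Set.univ =
      HypBM.volHyp n F * HypBM.sphMeasure n Set.univ := by
    rw [hL, Measure.map_apply measurable_quotient_mk'' MeasurableSet.univ,
      ← HypBM.liouvilleCover_preimage_foot hF]
    simp
  -- Finite volume enters only here.
  have hδ : HypBM.criticalExponent Γ x₀ = (n : ℝ) - 1 :=
    HypBM.criticalExponent_eq hn Γ hF (IsFundamentalDomain.mk' hF.nullMeasurableSet hdom)
      (hvoluniv ▸ hfinite.ne) x₀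
  have hBM : HypBM.bowenMargulisM Γ x₀ = (2 : ENNReal) ^ (n - 1) • HypBM.liouvilleM Γ := by
    rw [HypBM.bowenMargulisM, HypBM.bowenMargulisCover_eq hn Γ x₀ hδ, hL,
      HypBM.quoMeasure_eq Γ HypBM.measurable_smul_UT (fun g => by rw [Measure.map_smul, hinv g])
        (hfoot hF) hdom', Measure.restrict_smul, Measure.map_smul]
  refine ⟨hBM, ?_⟩
  rw [hBM, Measure.smul_apply, hLuniv, hvoluniv, smul_eq_mul]
  ring
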